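/- Let $h\in\mathbb C$, $q=e^{h}$ with $|q|>1$, and write $q^{\xi}=e^{\xi h}$ for $\xi\in\mathbb C$. Let $U_q(sl_2)$ be the algebra generated by $E,F,q^{\xi H}$ ($\xi\in\mathbb C$) with $q^{0H}=1$, $q^{\xi H}q^{\eta H}=q^{(\xi+\eta)H}$, $q^{\xi H}Eq^{-\xi H}=q^{2\xi}E$, $q^{\xi H}Fq^{-\xi H}=q^{-2\xi}F$, $[E,F]=\frac{q^{H}-q^{-H}}{q-q^{-1}}$. Let $s_0,s_1\in\mathbb Z$, $s=s_0+s_1$, $\epsilon_\pm\in\mathbb C\setminus\{0\}$, $k_\pm\in\mathbb C$, $x=q^{u}$ with $u\in\mathbb C$, and $x^{aH}=q^{uaH}$ for $a\in\mathbb Z$. Put $$\mathbf L(x)=\begin{pmatrix}q^{\frac H2}-q^{-1}x^{s}q^{-\frac H2}&(q-q^{-1})x^{s_0}Fq^{-\frac H2}\\(q-q^{-1})x^{s_1}Eq^{\frac H2}&q^{-\frac H2}-q^{-1}x^{s}q^{\frac H2}\end{pmatrix},\quad \overline{\mathbf L}(x)=\begin{pmatrix}q^{\frac H2}-q^{-1}x^{-s}q^{-\frac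 H2}&(q-q^{-1})x^{-s_1}Fq^{-\frac H2}\\(q-q^{-1})x^{-s_0}Eq^{\frac H2}&q^{-\frac H2}-q^{-1}x^{-s}q^{\frac H2}\end{pmatrix}$$ in $U_q(sl_2)\otimes\mathrm{End}(\mathbb C^2)$, and $$K(x)=\begin{pmatrix}x^{s_0}\epsilon_++x^{-s_1}\epsilon_-&\frac{k_+(x^{s}-x^{-s})}{q-q^{-1}}\\\frac{k_-(x^{s}-x^{-s})}{q-q^{-1}}&x^{-s_0}\epsilon_++x^{s_1}\epsilon_-\end{pmatrix}.$$ With $p=q^{-2}$, $(a;p)_\infty=\prod_{j\ge0}(1-ap^{j})$ and $\exp_p(a)=\sum_{k\ge0}a^{k}/(k)_p!$, where $(k)_p!=\prod_{j=1}^{k}\frac{1-p^{j}}{1-p}$, consider the four operators (a) for $k_-=0$: $\mathbf K(x)=x^{s_0H}\exp_p(\alpha_+Eq^{H})^{-1}\dfrac{(-\frac{\epsilon_-}{\epsilon_+}x^{s}q^{-H-1};p)_\infty}{(-\frac{\epsilon_-}{\epsilon_+}x^{-s}q^{-H-1};p)_\infty}\exp_p(\alpha_+Eq^{H})$, $\alpha_+=-\frac{qk_+x^{-s_0}}{(q-q^{-1})\epsilon_-}$;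 (b) for $k_+=0$: $\mathbf K(x)=x^{s_0H}\exp_p(\alpha_-F)\dfrac{(-\frac{\epsilon_-}{\epsilon_+}x^{s}q^{-H-1};p)_\infty}{(-\frac{\epsilon_-}{\epsilon_+}x^{-s}q^{-H-1};p)_\infty}\exp_p(\alpha_-F)^{-1}$, $\alpha_-=-\frac{k_-x^{s_0}}{(q-q^{-1})\epsilon_-}$; (c) for $k_+=0$: $\mathbf K(x)=x^{-s_1H}\exp_p(\beta_-Fq^{-H})^{-1}\dfrac{(-\frac{\epsilon_+}{\epsilon_-}x^{s}q^{H-1};p)_\infty}{(-\frac{\epsilon_+}{\epsilon_-}x^{-s}q^{H-1};p)_\infty}\exp_p(\beta_-Fq^{-H})$, $\beta_-=-\frac{qk_-x^{-s_1}}{(q-q^{-1})\epsilon_+}$; (d) for $k_-=0$: $\mathbf K(x)=x^{-s_1H}\exp_p(\beta_+E)\dfrac{(-\frac{\epsilon_+}{\epsilon_-}x^{s}q^{H-1};p)_\infty}{(-\frac{\epsilon_+}{\epsilon_-}x^{-s}q^{H-1};p)_\infty}\exp_p(\beta_+E)^{-1}$, $\beta_+=-\frac{k_+x^{s_1}}{(q-q^{-1})\epsilon_+}$.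 They are not elements of $U_q(sl_2)$; they are understood in any Hausdorff topological algebra $A$ (addition jointly and multiplication separately continuous) with an algebra homomorphism $\rho:U_q(sl_2)\to A$ such that the series and products occurring in the formula (applied to the $\rho$-images) converge and the elements whose inverses occur are invertible. (i) In every such $A$, each of (a)-(d), under its condition on $k_\pm$, satisfies for all $y\in\mathbb C^{\times}$ the reflection equation in $A\otimes\mathrm{End}(\mathbb C^2)$ $$\mathbf L_{12}\left(\tfrac yx\right)\mathbf K_1(x)\overline{\mathbf L}_{12}(xy)K_2(y)=K_2(y)\mathbf L_{12}\left(\tfrac1{xy}\right)\mathbf K_1(x)\overline{\mathbf L}_{12}\left(\tfrac xy\right),$$ and is also given by $$x^{s_0H}\frac{(-\frac{q^{-1}x^{s}}{\epsilon_+}T;p)_\infty}{(-\frac{q^{-1}x^{-s}}{\epsilon_+}T;p)_\infty}\ \text{ in cases (a), (b)},\qquad x^{-s_1H}\frac{(-\frac{q^{-1}x^{s}}{\epsilon_-}T;p)_\infty}{(-\frac{q^{-1}x^{-s}}{\epsilon_-}T;p)_\infty}\ \text{ in cases (c), (d)},$$ with $T=k_+x^{-s_0}E+\epsilon_-q^{-H}$,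 $T=k_-qx^{s_0}Fq^{-H}+\epsilon_-q^{-H}$, $T=k_-x^{-s_1}F+\epsilon_+q^{H}$, $T=k_+qx^{s_1}Eq^{H}+\epsilon_+q^{H}$ in cases (a), (b), (c), (d), respectively. (ii) (b) is the image of (a) under the anti-automorphism $\iota$: $E\mapsto q^{-H-1}F$, $F\mapsto Eq^{H+1}$, $q^{\xi H}\mapsto q^{\xi H}$, combined with $k_+\leftrightarrow k_-$. (c) and (d) are the images of (a) and (b) under the automorphism $\sigma$: $E\leftrightarrow F$, $q^{\xi H}\mapsto q^{-\xi H}$, combined with $s_0\leftrightarrow s_1$, $\epsilon_+\leftrightarrow\epsilon_-$, $k_+\leftrightarrow k_-$. (iii) In a finite-dimensional representation, (a) and (b) exist if every factor $1+\frac{\epsilon_-}{\epsilon_+}x^{-s}q^{-H-1}p^{j}$ ($j\ge0$) acts invertibly, and (c) and (d) exist if every factor $1+\frac{\epsilon_+}{\epsilon_-}x^{-s}q^{H-1}p^{j}$ does. (iv) Let $\pi$ be the fundamental representation: $\pi(E)=E_{12}$, $\pi(F)=E_{21}$, $\pi(q^{\xi H})=\mathrm{diag}(q^{\xi},q^{-\xi})$.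 If $1+\frac{\epsilon_-}{\epsilon_+}x^{-s}p^{j}\ne0$ for all $j\ge0$, then $\pi(\mathbf K(x))=\kappa(x)K(x)$ with $\kappa(x)=\dfrac{(-\frac{\epsilon_-}{\epsilon_+}x^{s}q^{-2};q^{-2})_\infty}{\epsilon_+(-\frac{\epsilon_-}{\epsilon_+}x^{-s};q^{-2})_\infty}$ in case (a) ($k_-=0$) and in case (b) ($k_+=0$). The same holds in cases (c) ($k_+=0$) and (d) ($k_-=0$), with $\epsilon_+$ and $\epsilon_-$ interchanged in the condition and in $\kappa$, the matrix $K(x)$ being unchanged. -/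

import Mathlib

open Filter Topology

noncomputable section

namespace QRefl

/-! Throughout `h : ℂ` is a logarithm of the deformation parameter: `q = exp h`, and
`q ^ ξ` means `exp (ξ h)` for every complex exponent `ξ`. -/

/-- `q ^ ξ = exp (ξ h)`. -/
def qpow (h ξ : ℂ) : ℂ := Complex.exp (ξ * h)

/-- The deformation parameter `q = exp h`. -/
def qq (h : ℂ) : ℂ := Complex.exp h

/-- `q - q⁻¹`. -/
def lam (h : ℂ) : ℂ := qq h - (qq h)⁻¹

/-- Generators of `U_q(sl₂)`: `E`, `F` and `q ^ (ξ H)` for `ξ ∈ ℂ`. -/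
inductive UqGen : Type
  | E : UqGen
  | F : UqGen
  | cart (ξ : ℂ) : UqGen

/-- The defining relations of `U_q(sl₂)`. -/
inductive UqRel (h : ℂ) : FreeAlgebra ℂ UqGen → FreeAlgebra ℂ UqGen → Prop
  | cart_zero : UqRel h (FreeAlgebra.ι ℂ (UqGen.cart 0)) 1
  | cart_add (ξ η : ℂ) :
      UqRel h (FreeAlgebra.ι ℂ (UqGen.cart ξ) * FreeAlgebra.ι ℂ (UqGen.cart η))
        (FreeAlgebra.ι ℂ (UqGen.cart (ξ + η)))
  | cart_E (ξ : ℂ) :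
      UqRel h (FreeAlgebra.ι ℂ (UqGen.cart ξ) * FreeAlgebra.ι ℂ UqGen.E *
          FreeAlgebra.ι ℂ (UqGen.cart (-ξ)))
        (qpow h (2 * ξ) • FreeAlgebra.ι ℂ UqGen.E)
  | cart_F (ξ : ℂ) :
      UqRel h (FreeAlgebra.ι ℂ (UqGen.cart ξ) * FreeAlgebra.ι ℂ UqGen.F *
          FreeAlgebra.ι ℂ (UqGen.cart (-ξ)))
        (qpow h (-(2 * ξ)) • FreeAlgebra.ι ℂ UqGen.F)
  | E_F :
      UqRel h (FreeAlgebra.ι ℂ UqGen.E * FreeAlgebra.ι ℂ UqGen.F -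
          FreeAlgebra.ι ℂ UqGen.F * FreeAlgebra.ι ℂ UqGen.E)
        ((lam h)⁻¹ • (FreeAlgebra.ι ℂ (UqGen.cart 1) - FreeAlgebra.ι ℂ (UqGen.cart (-1))))

/-- The quantum algebra `U_q(sl₂)`, as a complex unital associative algebra. -/
def Uq (h : ℂ) : Type := RingQuot (UqRel h)

instance (h : ℂ) : Ring (Uq h) := inferInstanceAs (Ring (RingQuot (UqRel h)))

instance (h : ℂ) : Algebra ℂ (Uq h) := inferInstanceAs (Algebra ℂ (RingQuot (UqRel h)))

/-- The quotient map from the free algebra. -/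
def mkUq (h : ℂ) : FreeAlgebra ℂ UqGen →ₐ[ℂ] Uq h := RingQuot.mkAlgHom ℂ (UqRel h)

theorem mkUq_rel {h : ℂ} {a b : FreeAlgebra ℂ UqGen} (r : UqRel h a b) :
    mkUq h a = mkUq h b := RingQuot.mkAlgHom_rel ℂ r

/-- The class of a generator. -/
def gen (h : ℂ) (g : UqGen) : Uq h := mkUq h (FreeAlgebra.ι ℂ g)

/-- The generator `E`. -/
def E (h : ℂ) : Uq h := gen h UqGen.E

/-- The generator `F`. -/
def F (h : ℂ) : Uq h := gen h UqGen.F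

/-- The generator `q ^ (ξ H)`. -/
def qH (h ξ : ℂ) : Uq h := gen h (UqGen.cart ξ)

theorem qH_zero (h : ℂ) : qH h 0 = 1 := by
  simpa [qH, gen] using mkUq_rel (UqRel.cart_zero (h := h))

theorem qH_mul (h ξ η : ℂ) : qH h ξ * qH h η = qH h (ξ + η) := by
  simpa [qH, gen] using mkUq_rel (UqRel.cart_add (h := h) ξ η)

theorem qH_E (h ξ : ℂ) : qH h ξ * E h * qH h (-ξ) = qpow h (2 * ξ) • E h := by
  simpa [qH, gen, E] using mkUq_rel (UqRel.cart_E (h := h) ξ)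

theorem qH_F (h ξ : ℂ) : qH h ξ * F h * qH h (-ξ) = qpow h (-(2 * ξ)) • F h := by
  simpa [qH, gen, F] using mkUq_rel (UqRel.cart_F (h := h) ξ)

theorem E_F (h : ℂ) :
    E h * F h - F h * E h = (lam h)⁻¹ • (qH h 1 - qH h (-1)) := by
  simpa [qH, gen, F, E] using mkUq_rel (UqRel.E_F (h := h))

/-- Algebra homomorphisms out of `U_q(sl₂)` from images of the generators that satisfy the
defining relations. -/
def liftUq (h : ℂ) {B : Type*} [Ring B] [Algebra ℂ B] (e f : B) (k : ℂ → B)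
    (k0 : k 0 = 1) (kadd : ∀ ξ η, k ξ * k η = k (ξ + η))
    (ke : ∀ ξ, k ξ * e * k (-ξ) = qpow h (2 * ξ) • e)
    (kf : ∀ ξ, k ξ * f * k (-ξ) = qpow h (-(2 * ξ)) • f)
    (ef : e * f - f * e = (lam h)⁻¹ • (k 1 - k (-1))) : Uq h →ₐ[ℂ] B :=
  RingQuot.liftAlgHom ℂ
    ⟨FreeAlgebra.lift ℂ (fun g => match g with
      | UqGen.E => e
      | UqGen.F => f
      | UqGen.cart ξ => k ξ), by
      intro a b r
      cases r with
      | cart_zero => simpa using k0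
      | cart_add ξ η => simpa using kadd ξ η
      | cart_E ξ => simpa using ke ξ
      | cart_F ξ => simpa using kf ξ
      | E_F => simpa using ef⟩

/-- The automorphism `σ`: `E ↦ F`, `F ↦ E`, `q ^ (ξ H) ↦ q ^ (-ξ H)`. -/
def sigma (h : ℂ) : Uq h →ₐ[ℂ] Uq h :=
  liftUq h (F h) (E h) (fun ξ => qH h (-ξ))
    (by simpa using qH_zero h)
    (fun ξ η => by rw [qH_mul]; congr 1; ring)
    (fun ξ => by rw [qH_F]; congr 2; ring)
    (fun ξ => by rw [qH_E]; congr 2; ring)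
    (by
      rw [← neg_sub, E_F, ← smul_neg, neg_sub, neg_neg])

theorem qH_neg_F_E (h : ℂ) : qH h (-1) * (F h * E h) * qH h 1 = F h * E h := by
  have e1 := qH_E h (-1)
  have f1 := qH_F h (-1)
  rw [neg_neg] at e1 f1
  have k : qH h 1 * qH h (-1) = 1 := by rw [qH_mul, add_neg_cancel, qH_zero]
  calc qH h (-1) * (F h * E h) * qH h 1
      = qH h (-1) * F h * 1 * E h * qH h 1 := by noncomm_ring
    _ = (qH h (-1) * F h * qH h 1) * (qH h (-1) * E h * qH h 1) := by
        rw [← k]; noncomm_ring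
    _ = F h * E h := by
        rw [e1, f1, smul_mul_smul_comm, qpow, qpow, ← Complex.exp_add]
        simp

/-- The anti-automorphism `ι`: `E ↦ q ^ (-H-1) F`, `F ↦ E q ^ (H+1)`,
`q ^ (ξ H) ↦ q ^ (ξ H)`, as a homomorphism to the opposite algebra. -/
def iota (h : ℂ) : Uq h →ₐ[ℂ] (Uq h)ᵐᵒᵖ :=
  liftUq h (MulOpposite.op ((qq h)⁻¹ • (qH h (-1) * F h)))
    (MulOpposite.op (qq h • (E h * qH h 1)))
    (fun ξ => MulOpposite.op (qH h ξ))
    (by rw [qH_zero]; rfl)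
    (fun ξ η => by rw [← MulOpposite.op_mul, qH_mul, add_comm])
    (fun ξ => by
      rw [← MulOpposite.op_mul, ← MulOpposite.op_mul, ← MulOpposite.op_smul]
      congr 1
      have f1 := qH_F h (-ξ)
      rw [neg_neg] at f1
      rw [smul_mul_assoc, mul_smul_comm, smul_comm]
      congr 1
      calc qH h (-ξ) * (qH h (-1) * F h * qH h ξ)
          = (qH h (-ξ) * qH h (-1)) * F h * qH h ξ := by noncomm_ring
        _ = qH h (-1) * (qH h (-ξ) * F h * qH h ξ) := by
            rw [qH_mul, add_comm, ← qH_mul]; noncomm_ring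
        _ = qpow h (2 * ξ) • (qH h (-1) * F h) := by
            rw [f1, mul_smul_comm]; congr 2; ring)
    (fun ξ => by
      rw [← MulOpposite.op_mul, ← MulOpposite.op_mul, ← MulOpposite.op_smul]
      congr 1
      have e1 := qH_E h (-ξ)
      rw [neg_neg] at e1
      rw [smul_mul_assoc, mul_smul_comm, smul_comm]
      congr 1
      calc qH h (-ξ) * (E h * qH h 1 * qH h ξ)
          = qH h (-ξ) * E h * (qH h 1 * qH h ξ) := by noncomm_ring
        _ = (qH h (-ξ) * E h * qH h ξ) * qH h 1 := by
            rw [qH_mul, add_comm, ← qH_mul]; noncomm_ring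
        _ = qpow h (-(2 * ξ)) • (E h * qH h 1) := by
            rw [e1, smul_mul_assoc]; congr 2; ring)
    (by
      have hq : qq h ≠ 0 := Complex.exp_ne_zero _
      have k : qH h 1 * qH h (-1) = 1 := by rw [qH_mul, add_neg_cancel, qH_zero]
      rw [← MulOpposite.op_mul, ← MulOpposite.op_mul, ← MulOpposite.op_sub,
        ← MulOpposite.op_sub, ← MulOpposite.op_smul]
      congr 1
      rw [smul_mul_smul_comm, smul_mul_smul_comm, mul_inv_cancel₀ hq, inv_mul_cancel₀ hq,
        one_smul, one_smul, ← E_F]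
      congr 1
      · calc E h * qH h 1 * (qH h (-1) * F h) = E h * (qH h 1 * qH h (-1)) * F h := by
              noncomm_ring
          _ = E h * F h := by rw [k, mul_one]
      · calc qH h (-1) * F h * (E h * qH h 1) = qH h (-1) * (F h * E h) * qH h 1 := by
              noncomm_ring
          _ = F h * E h := qH_neg_F_E h)

theorem lam_ne_zero (h : ℂ) (hq : 1 < ‖qq h‖) : lam h ≠ 0 := by
  intro hl
  have h0 : qq h ≠ 0 := Complex.exp_ne_zero _
  have h1 : qq h * qq h = 1 := by
    have h2 : qq h = (qq h)⁻¹ := sub_eq_zero.mp hl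
    calc qq h * qq h = qq h * (qq h)⁻¹ := by rw [← h2]
      _ = 1 := mul_inv_cancel₀ h0
  have h3 : ‖qq h‖ * ‖qq h‖ = 1 := by rw [← norm_mul, h1, norm_one]
  nlinarith

/-- The fundamental representation `π`: `E ↦ E₁₂`, `F ↦ E₂₁`,
`q ^ (ξ H) ↦ q ^ ξ E₁₁ + q ^ (-ξ) E₂₂`. -/
def fund (h : ℂ) (hq : 1 < ‖qq h‖) : Uq h →ₐ[ℂ] Matrix (Fin 2) (Fin 2) ℂ :=
  liftUq h !![0, 1; 0, 0] !![0, 0; 1, 0] (fun ξ => !![qpow h ξ, 0; 0, qpow h (-ξ)])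
    (by simp [qpow, Matrix.one_fin_two])
    (fun ξ η => by
      ext i j
      fin_cases i <;> fin_cases j <;>
        simp [qpow, ← Complex.exp_add] <;> ring_nf)
    (fun ξ => by
      ext i j
      fin_cases i <;> fin_cases j <;>
        simp [qpow, ← Complex.exp_add] <;> ring_nf)
    (fun ξ => by
      ext i j
      fin_cases i <;> fin_cases j <;>
        simp [qpow, ← Complex.exp_add]; ring_nf)
    (by
      have hl := lam_ne_zero h hq
      have e1 : qpow h 1 - qpow h (-1) = lam h := by
        simp [qpow, lam, qq, Complex.exp_neg]
      have e2 : qpow h (-1) - qpow h 1 = -lam h := by rw [← e1]; ring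
      ext i j
      fin_cases i <;> fin_cases j <;> simp [e1, e2, hl])

/-! ### q-exponential and infinite q-shifted factorial in a topological algebra -/

/-- `(k)_p! = (1)_p (2)_p ⋯ (k)_p` with `(j)_p = (1 - p ^ j) / (1 - p)`. -/
def qFact (p : ℂ) (k : ℕ) : ℂ := ∏ j ∈ Finset.range k, (1 - p ^ (j + 1)) / (1 - p)

/-- `(a; p)_n = (1 - a) (1 - a p) ⋯ (1 - a p ^ (n - 1))`. -/
def qPoch {A : Type*} [Ring A] [Algebra ℂ A] (p : ℂ) (a : A) : ℕ → A
  | 0 => 1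
  | n + 1 => qPoch p a n * (1 - p ^ n • a)

/-- `exp_p(a)` converges and is equal to `b`. -/
def HasQExp {A : Type*} [Ring A] [Algebra ℂ A] [TopologicalSpace A] (p : ℂ) (a b : A) : Prop :=
  Tendsto (fun n : ℕ => ∑ k ∈ Finset.range n, (qFact p k)⁻¹ • a ^ k) atTop (𝓝 b)

/-- `(a; p)_∞` converges and is equal to `b`. -/
def HasQPoch {A : Type*} [Ring A] [Algebra ℂ A] [TopologicalSpace A] (p : ℂ) (a b : A) : Prop :=
  Tendsto (qPoch p a) atTop (𝓝 b)

/-! ### Parameters, L-operators and K-matrix -/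

/-- The free parameters: gradation integers `s₀, s₁` and scalars `ε₊, ε₋, k₊, k₋`. -/
structure Params where
  s₀ : ℤ
  s₁ : ℤ
  εp : ℂ
  εm : ℂ
  kp : ℂ
  km : ℂ

namespace Params

/-- `s = s₀ + s₁`. -/
def s (P : Params) : ℤ := P.s₀ + P.s₁

/-- The action of `σ` on the parameters. -/
def sigma (P : Params) : Params := ⟨P.s₁, P.s₀, P.εm, P.εp, P.km, P.kp⟩

/-- The action of `ι` on the parameters. -/
def iota (P : Params) : Params := ⟨P.s₀, P.s₁, P.εp, P.εm, P.km, P.kp⟩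

end Params

/-- The L-operator `L(x) ∈ U_q(sl₂) ⊗ End(ℂ²)`, as a `2 × 2` matrix over `U_q(sl₂)`. -/
def Lop (h : ℂ) (P : Params) (x : ℂ) : Matrix (Fin 2) (Fin 2) (Uq h) :=
  !![qH h (1 / 2) - ((qq h)⁻¹ * x ^ P.s) • qH h (-(1 / 2)),
      (lam h * x ^ P.s₀) • (F h * qH h (-(1 / 2)));
    (lam h * x ^ P.s₁) • (E h * qH h (1 / 2)),
      qH h (-(1 / 2)) - ((qq h)⁻¹ * x ^ P.s) • qH h (1 / 2)]

/-- The L-operator `L̄(x) ∈ U_q(sl₂) ⊗ End(ℂ²)`. -/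
def LopBar (h : ℂ) (P : Params) (x : ℂ) : Matrix (Fin 2) (Fin 2) (Uq h) :=
  !![qH h (1 / 2) - ((qq h)⁻¹ * x ^ (-P.s)) • qH h (-(1 / 2)),
      (lam h * x ^ (-P.s₁)) • (F h * qH h (-(1 / 2)));
    (lam h * x ^ (-P.s₀)) • (E h * qH h (1 / 2)),
      qH h (-(1 / 2)) - ((qq h)⁻¹ * x ^ (-P.s)) • qH h (1 / 2)]

/-- The scalar `2 × 2` K-matrix. -/
def Kmat (h : ℂ) (P : Params) (x : ℂ) : Matrix (Fin 2) (Fin 2) ℂ :=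
  !![x ^ P.s₀ * P.εp + x ^ (-P.s₁) * P.εm, P.kp * (x ^ P.s - x ^ (-P.s)) / lam h;
    P.km * (x ^ P.s - x ^ (-P.s)) / lam h, x ^ (-P.s₀) * P.εp + x ^ P.s₁ * P.εm]

/-- The reflection equation
`L₁₂(y/x) K₁(x) L̄₁₂(xy) K₂(y) = K₂(y) L₁₂(1/(xy)) K₁(x) L̄₁₂(x/y)`
for an operator `K = K(x)` in an algebra `A` which receives `U_q(sl₂)` through `ρ`; both sides
are elements of `A ⊗ End(ℂ²)`, written as `2 × 2` matrices over `A`. -/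
def ReflectionEq (h : ℂ) (P : Params) {A : Type*} [Ring A] [Algebra ℂ A] (ρ : Uq h →ₐ[ℂ] A)
    (K : A) (x y : ℂ) : Prop :=
  (Lop h P (y / x)).map ρ * Matrix.diagonal (fun _ => K) * (LopBar h P (x * y)).map ρ *
      (Kmat h P y).map (algebraMap ℂ A) =
    (Kmat h P y).map (algebraMap ℂ A) * (Lop h P (1 / (x * y))).map ρ *
      Matrix.diagonal (fun _ => K) * (LopBar h P (x / y)).map ρ

/-! ### The triangular K-operators, for `x = q ^ u` and `p = q ^ (-2)`

For an algebra homomorphism `ρ` from `U_q(sl₂)` to a topological algebra `A`, each predicate says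
that the series and products which occur in the formula converge in `A`, that the elements whose
inverses occur are invertible, and that `K` is the value of the formula. -/

/-- The base `q ^ (-2)`. -/
def pp (h : ℂ) : ℂ := (qq h ^ 2)⁻¹

/-- `-(ε₋/ε₊) X q ^ (-H-1)`. -/
def cartLow (h : ℂ) (P : Params) (X : ℂ) : Uq h :=
  (-(P.εm / P.εp) * X * (qq h)⁻¹) • qH h (-1)

/-- `-(ε₊/ε₋) X q ^ (H-1)`. -/
def cartHigh (h : ℂ) (P : Params) (X : ℂ) : Uq h :=
  (-(P.εp / P.εm) * X * (qq h)⁻¹) • qH h 1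

section

variable {A : Type*} [Ring A] [Algebra ℂ A] [TopologicalSpace A]

/-- Upper triangular, first type:
`x^{s₀H} exp⁻¹(α₊ E q^H) · (cartLow(x^s); p)_∞ / (cartLow(x^{-s}); p)_∞ · exp(α₊ E q^H)` with
`α₊ = - q k₊ x^{-s₀} / ((q - q⁻¹) ε₋)`. -/
def IsKUp (h : ℂ) (P : Params) (u : ℂ) (ρ : Uq h →ₐ[ℂ] A) (K : A) : Prop :=
  ∃ (X D : Aˣ) (N : A),
    HasQExp (pp h)
      (ρ ((-(qq h * P.kp * qpow h u ^ (-P.s₀)) / (lam h * P.εm)) • (E h * qH h 1))) (X : A) ∧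
    HasQPoch (pp h) (ρ (cartLow h P (qpow h u ^ P.s))) N ∧
    HasQPoch (pp h) (ρ (cartLow h P (qpow h u ^ (-P.s)))) (D : A) ∧
    K = ρ (qH h (u * P.s₀)) * ↑X⁻¹ * (N * ↑D⁻¹) * X

/-- The second expression for the same operator:
a ratio of infinite products in `k₊ x^{-s₀} E + ε₋ q^{-H}`. -/
def IsKUpAlt (h : ℂ) (P : Params) (u : ℂ) (ρ : Uq h →ₐ[ℂ] A) (K : A) : Prop :=
  ∃ (D : Aˣ) (N : A),
    HasQPoch (pp h) (ρ ((-((qq h)⁻¹ * qpow h u ^ P.s) / P.εp) •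
      ((P.kp * qpow h u ^ (-P.s₀)) • E h + P.εm • qH h (-1)))) N ∧
    HasQPoch (pp h) (ρ ((-((qq h)⁻¹ * qpow h u ^ (-P.s)) / P.εp) •
      ((P.kp * qpow h u ^ (-P.s₀)) • E h + P.εm • qH h (-1)))) (D : A) ∧
    K = ρ (qH h (u * P.s₀)) * (N * ↑D⁻¹)

/-- Lower triangular, first type:
`x^{s₀H} exp(α₋ F) · (cartLow(x^s); p)_∞ / (cartLow(x^{-s}); p)_∞ · exp⁻¹(α₋ F)` with
`α₋ = - k₋ x^{s₀} / ((q - q⁻¹) ε₋)`. -/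
def IsKLo (h : ℂ) (P : Params) (u : ℂ) (ρ : Uq h →ₐ[ℂ] A) (K : A) : Prop :=
  ∃ (X D : Aˣ) (N : A),
    HasQExp (pp h)
      (ρ ((-(P.km * qpow h u ^ P.s₀) / (lam h * P.εm)) • F h)) (X : A) ∧
    HasQPoch (pp h) (ρ (cartLow h P (qpow h u ^ P.s))) N ∧
    HasQPoch (pp h) (ρ (cartLow h P (qpow h u ^ (-P.s)))) (D : A) ∧
    K = ρ (qH h (u * P.s₀)) * X * (N * ↑D⁻¹) * ↑X⁻¹

/-- The second expression for the same operator: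
a ratio of infinite products in `k₋ q x^{s₀} F q^{-H} + ε₋ q^{-H}`. -/
def IsKLoAlt (h : ℂ) (P : Params) (u : ℂ) (ρ : Uq h →ₐ[ℂ] A) (K : A) : Prop :=
  ∃ (D : Aˣ) (N : A),
    HasQPoch (pp h) (ρ ((-((qq h)⁻¹ * qpow h u ^ P.s) / P.εp) •
      ((P.km * qq h * qpow h u ^ P.s₀) • (F h * qH h (-1)) + P.εm • qH h (-1)))) N ∧
    HasQPoch (pp h) (ρ ((-((qq h)⁻¹ * qpow h u ^ (-P.s)) / P.εp) •
      ((P.km * qq h * qpow h u ^ P.s₀) • (F h * qH h (-1)) + P.εm • qH h (-1)))) (D : A) ∧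
    K = ρ (qH h (u * P.s₀)) * (N * ↑D⁻¹)

/-- Lower triangular, second type:
`x^{-s₁H} exp⁻¹(β₋ F q^{-H}) · (cartHigh(x^s); p)_∞ / (cartHigh(x^{-s}); p)_∞ · exp(β₋ F q^{-H})`
with `β₋ = - q k₋ x^{-s₁} / ((q - q⁻¹) ε₊)`. -/
def IsKLo' (h : ℂ) (P : Params) (u : ℂ) (ρ : Uq h →ₐ[ℂ] A) (K : A) : Prop :=
  ∃ (X D : Aˣ) (N : A),
    HasQExp (pp h)
      (ρ ((-(qq h * P.km * qpow h u ^ (-P.s₁)) / (lam h * P.εp)) • (F h * qH h (-1)))) (X : A) ∧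
    HasQPoch (pp h) (ρ (cartHigh h P (qpow h u ^ P.s))) N ∧
    HasQPoch (pp h) (ρ (cartHigh h P (qpow h u ^ (-P.s)))) (D : A) ∧
    K = ρ (qH h (-(u * P.s₁))) * ↑X⁻¹ * (N * ↑D⁻¹) * X

/-- The second expression for the same operator:
a ratio of infinite products in `k₋ x^{-s₁} F + ε₊ q^H`. -/
def IsKLoAlt' (h : ℂ) (P : Params) (u : ℂ) (ρ : Uq h →ₐ[ℂ] A) (K : A) : Prop :=
  ∃ (D : Aˣ) (N : A),
    HasQPoch (pp h) (ρ ((-((qq h)⁻¹ * qpow h u ^ P.s) / P.εm) •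
      ((P.km * qpow h u ^ (-P.s₁)) • F h + P.εp • qH h 1))) N ∧
    HasQPoch (pp h) (ρ ((-((qq h)⁻¹ * qpow h u ^ (-P.s)) / P.εm) •
      ((P.km * qpow h u ^ (-P.s₁)) • F h + P.εp • qH h 1))) (D : A) ∧
    K = ρ (qH h (-(u * P.s₁))) * (N * ↑D⁻¹)

/-- Upper triangular, second type:
`x^{-s₁H} exp(β₊ E) · (cartHigh(x^s); p)_∞ / (cartHigh(x^{-s}); p)_∞ · exp⁻¹(β₊ E)` with
`β₊ = - k₊ x^{s₁} / ((q - q⁻¹) ε₊)`. -/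
def IsKUp' (h : ℂ) (P : Params) (u : ℂ) (ρ : Uq h →ₐ[ℂ] A) (K : A) : Prop :=
  ∃ (X D : Aˣ) (N : A),
    HasQExp (pp h)
      (ρ ((-(P.kp * qpow h u ^ P.s₁) / (lam h * P.εp)) • E h)) (X : A) ∧
    HasQPoch (pp h) (ρ (cartHigh h P (qpow h u ^ P.s))) N ∧
    HasQPoch (pp h) (ρ (cartHigh h P (qpow h u ^ (-P.s)))) (D : A) ∧
    K = ρ (qH h (-(u * P.s₁))) * X * (N * ↑D⁻¹) * ↑X⁻¹

/-- The second expression for the same operator: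
a ratio of infinite products in `k₊ q x^{s₁} E q^H + ε₊ q^H`. -/
def IsKUpAlt' (h : ℂ) (P : Params) (u : ℂ) (ρ : Uq h →ₐ[ℂ] A) (K : A) : Prop :=
  ∃ (D : Aˣ) (N : A),
    HasQPoch (pp h) (ρ ((-((qq h)⁻¹ * qpow h u ^ P.s) / P.εm) •
      ((P.kp * qq h * qpow h u ^ P.s₁) • (E h * qH h 1) + P.εp • qH h 1))) N ∧
    HasQPoch (pp h) (ρ ((-((qq h)⁻¹ * qpow h u ^ (-P.s)) / P.εm) •
      ((P.kp * qq h * qpow h u ^ P.s₁) • (E h * qH h 1) + P.εp • qH h 1))) (D : A) ∧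
    K = ρ (qH h (-(u * P.s₁))) * (N * ↑D⁻¹)

end

/-- `κ` is the overall factor `(-r x^s q⁻²; q⁻²)_∞ / (ε (-r x^{-s}; q⁻²)_∞)`, the denominator
being nonzero. -/
def IsKappa (h : ℂ) (P : Params) (u ε r κ : ℂ) : Prop :=
  ∃ a b : ℂ, b ≠ 0 ∧ HasQPoch (pp h) (-r * qpow h u ^ P.s * pp h) a ∧
    HasQPoch (pp h) (-r * qpow h u ^ (-P.s)) b ∧ κ = a / (ε * b)

end QRefl

end

/-!
Write `k = q ^ H`, `b = k⁻¹`, `p = q ^ (-2)` and `S = x ^ s`. The first upper triangular operator is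
`K = x ^ (s₀ H) Ψ` with `Ψ = X⁻¹ N D⁻¹ X`, where `X` is a `p`-exponential of a multiple of `E k`,
and `N`, `D` are infinite `p`-shifted factorials of multiples of `b`.

**Second expression.** The difference equation of the `p`-exponential (`HasQExp.qcomm`) shows that
conjugation by `X` takes `ε₋ b` to `T = c E + ε₋ b`, where `c = k₊ x ^ (-s₀)`
(`conjHom_cartan`). Since conjugation commutes with the formation of infinite products, `Ψ` is a
ratio of shifted factorials of multiples of `T` (`IsKUp.alt`).

**Reflection equation.** Before the dressing, `E k` lowers the argument of `N` and `D` by a factor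
`p`, and `F b` raises it, so that one factor of the infinite products telescopes away
(`HasQPoch.lower`, `HasQPoch.raise`). Conjugation by `X` fixes `E k` and takes `F b` to
`F b + γ b - γ ε₋ T⁻¹` (`conjHom_opposite`), which follows from the commutator of the
`p`-exponential with `F b` (`HasQExp.cartan`). Hence `Ψ` commutes with `T` and satisfies explicit
relations with `E k`, `k` and `F` (`dressed_relations`). On the other side, for `k₋ = 0` the
entries of the reflection equation are combinations of four identities that do not involve the
spectral parameter `y` (`reflection_of_relations`), and these are the relations of `Ψ` multiplied by
group-like elements (`relations_of_dressed`).

**The other three operators.** The automorphism `σ` permutes the two basis vectors of `ℂ²` in the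
L-operators and in the scalar K-matrix (`ReflectionEq.of_sigma`). The anti-automorphism `ι` acts on
the L-operators as transposition in `End(ℂ²)`, exchanges `L(z)` with `L̄(1/z)` and thereby exchanges
the two sides of the reflection equation (`ReflectionEq.of_iota`). It is used as a homomorphism to
the opposite algebra, so that what is known about the first operator in *every* algebra applies.

**Existence.** In a finite-dimensional representation the root vectors are nilpotent, because
conjugation by a group-like element rescales them by a factor of modulus greater than one
(`isNilpotent_of_conj`); their `p`-exponentials are then finite sums of the form `1 + nilpotent`,
hence invertible. The infinite products converge in any Banach algebra, together with the products
of the inverse factors if the factors are invertible (`exists_unit_hasQPoch`).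

**Fundamental representation.** There the square of a root vector vanishes and all products are
diagonal, which leaves an identity of `2 × 2` matrices (`fund_low`, `fund_high`).
-/

namespace QRefl

/-! ### The infinite `p`-shifted factorial -/

section Limits

variable {A : Type*} [Ring A] [Algebra ℂ A]

theorem commute_qPoch {p : ℂ} {a c : A} (hc : Commute c a) (n : ℕ) : Commute c (qPoch p a n) := by
  induction n with
  | zero => exact Commute.one_right c
  | succ n ih =>
    exact ih.mul_right ((Commute.one_right c).sub_right (hc.smul_right _))

theorem qPoch_semiconj {p : ℂ} {a a' y : A} (hy : y * a = a' * y) (n : ℕ) :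
    y * qPoch p a n = qPoch p a' n * y := by
  have hs : SemiconjBy y a a' := hy
  induction n with
  | zero => exact SemiconjBy.one_right y
  | succ n ih =>
    exact SemiconjBy.mul_right ih ((SemiconjBy.one_right y).sub_right (by
      change y * (p ^ n • a) = (p ^ n • a') * y
      rw [mul_smul_comm, smul_mul_assoc, hy]))

/-- Splitting off the first factor instead of the last one. -/
theorem qPoch_succ' (p : ℂ) (a : A) (n : ℕ) :
    qPoch p a (n + 1) = (1 - a) * qPoch p (p • a) n := by
  induction n with
  | zero => simp [qPoch]
  | succ n ih =>
    rw [qPoch, ih, mul_assoc]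
    congr 1
    rw [qPoch, smul_smul, pow_succ]

variable [TopologicalSpace A] [IsSemitopologicalRing A]

theorem HasQPoch.const_mul {p : ℂ} {a N : A} (hN : HasQPoch p a N) (y : A) :
    Tendsto (fun n => y * qPoch p a n) atTop (𝓝 (y * N)) :=
  ((continuous_const_mul y).tendsto N).comp hN

theorem HasQPoch.mul_const {p : ℂ} {a N : A} (hN : HasQPoch p a N) (y : A) :
    Tendsto (fun n => qPoch p a n * y) atTop (𝓝 (N * y)) :=
  ((continuous_mul_const y).tendsto N).comp hN

theorem HasQPoch.conj {p : ℂ} {a N : A} (hN : HasQPoch p a N) (W : Aˣ) :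
    HasQPoch p (↑W⁻¹ * a * W) (↑W⁻¹ * N * W) := by
  refine (((continuous_mul_const (W : A)).tendsto _).comp (hN.const_mul (↑W⁻¹ : A))).congr
    fun n => ?_
  have := qPoch_semiconj (p := p) (a := a) (a' := ↑W⁻¹ * a * W) (y := (↑W⁻¹ : A))
    (by rw [mul_assoc _ (W : A), Units.mul_inv, mul_one]) n
  simp [Function.comp, this]

variable [T2Space A]

theorem HasQPoch.commute {p : ℂ} {a N c : A} (hN : HasQPoch p a N) (hc : Commute c a) :
    Commute c N :=
  tendsto_nhds_unique (hN.const_mul c)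
    ((hN.mul_const c).congr fun n => ((commute_qPoch hc n).eq).symm)

/-- If `f` raises the argument by one step, `f w = p w f`, then passing `(w; p)_∞` through `f`
removes the first factor. -/
theorem HasQPoch.raise {p : ℂ} {w N f : A} (hN : HasQPoch p w N) (hf : f * w = p • (w * f)) :
    (1 - w) * (f * N) = N * f := by
  have h1 := (hN.const_mul f)
  have h2 := ((continuous_const_mul (1 - w)).tendsto _).comp h1
  refine tendsto_nhds_unique h2 (((hN.mul_const f).comp (tendsto_add_atTop_nat 1)).congr
    fun n => ?_)
  have := qPoch_semiconj (p := p) (a := w) (a' := p • w) (y := f)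
    (by rw [hf, smul_mul_assoc]) n
  simp only [Function.comp, qPoch_succ', this, mul_assoc]

/-- If `y` lowers the argument by one step, `w y = p y w`, then passing `(w; p)_∞` through `y`
creates one more factor. -/
theorem HasQPoch.lower {p : ℂ} {w N y : A} (hN : HasQPoch p w N) (hy : w * y = p • (y * w)) :
    N * y * (1 - w) = y * N := by
  have h1 := ((continuous_mul_const (1 - w)).tendsto _).comp (hN.mul_const y)
  refine tendsto_nhds_unique h1 (((hN.const_mul y).comp (tendsto_add_atTop_nat 1)).congr
    fun n => ?_)
  have h2 := qPoch_semiconj (p := p) (a := p • w) (a' := w) (y := y)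
    (by rw [hy, mul_smul_comm]) n
  have h3 : Commute (1 - w) (qPoch p (p • w) n) :=
    commute_qPoch (((Commute.one_left w).sub_left (Commute.refl w)).smul_right p) n
  simp only [Function.comp]
  rw [← h2, qPoch_succ', h3.eq, mul_assoc]

end Limits

/-! ### The `p`-exponential -/

/-- The partial sums of `exp_p(a)`. -/
noncomputable def qExpSum {A : Type*} [Ring A] [Algebra ℂ A] (p : ℂ) (a : A) (n : ℕ) : A :=
  ∑ k ∈ Finset.range n, (qFact p k)⁻¹ • a ^ k

section PartialSums

variable {A : Type*} [Ring A] [Algebra ℂ A]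

theorem qExpSum_succ (p : ℂ) (a : A) (n : ℕ) :
    qExpSum p a (n + 1) = qExpSum p a n + (qFact p n)⁻¹ • a ^ n := Finset.sum_range_succ _ _

theorem one_sub_pow_ne_zero {p : ℂ} (hp : ‖p‖ < 1) (n : ℕ) : 1 - p ^ (n + 1) ≠ 0 := by
  intro h0
  have h1 : ‖p ^ (n + 1)‖ = 1 := by rw [← sub_eq_zero.mp h0, norm_one]
  rw [norm_pow] at h1
  exact absurd h1 (pow_lt_one₀ (norm_nonneg _) hp (Nat.succ_ne_zero n)).ne

theorem one_sub_ne_zero_of_norm {p : ℂ} (hp : ‖p‖ < 1) : 1 - p ≠ 0 := by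
  simpa using one_sub_pow_ne_zero hp 0

theorem qFact_succ_inv {p : ℂ} (hp : ‖p‖ < 1) (n : ℕ) :
    (1 - p ^ (n + 1)) * (qFact p (n + 1))⁻¹ = (1 - p) * (qFact p n)⁻¹ := by
  have h1 := one_sub_pow_ne_zero hp n
  have h2 := one_sub_ne_zero_of_norm hp
  rw [qFact, Finset.prod_range_succ, ← qFact, mul_inv, inv_div]
  field_simp

theorem qExpSum_semiconj {p : ℂ} {a a' y : A} (hy : y * a = a' * y) (n : ℕ) :
    y * qExpSum p a n = qExpSum p a' n * y := by
  have hs : SemiconjBy y a a' := hy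
  rw [qExpSum, qExpSum, Finset.mul_sum, Finset.sum_mul]
  refine Finset.sum_congr rfl fun k _ => ?_
  rw [mul_smul_comm, smul_mul_assoc, (hs.pow_right k).eq]

theorem mul_pow_of_qcomm {p : ℂ} {a b : A} (hb : b * a = p • (a * b)) (n : ℕ) :
    b * a ^ n = p ^ n • (a ^ n * b) := by
  induction n with
  | zero => simp
  | succ n ih =>
    rw [pow_succ, ← mul_assoc, ih, smul_mul_assoc, mul_assoc, hb, mul_smul_comm, smul_smul,
      ← mul_assoc, pow_succ]

/-- Truncated form of the `p`-difference equation of the exponential. -/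
theorem qExpSum_qcomm {p : ℂ} (hp : ‖p‖ < 1) {a b : A} (hb : b * a = p • (a * b)) (n : ℕ) :
    b * qExpSum p a (n + 1) = qExpSum p a (n + 1) * b - (1 - p) • (a * qExpSum p a n * b) := by
  induction n with
  | zero => simp [qExpSum]
  | succ n ih =>
    rw [qExpSum_succ _ _ (n + 1), mul_add, ih, qExpSum_succ _ _ n, mul_smul_comm,
      mul_pow_of_qcomm hb]
    have h1 := qFact_succ_inv hp n
    have h2 : (qFact p (n + 1))⁻¹ * p ^ (n + 1)
        = (qFact p (n + 1))⁻¹ - (1 - p) * (qFact p n)⁻¹ := by rw [← h1]; ring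
    rw [smul_smul, h2]
    simp only [add_mul, mul_add, smul_mul_assoc, mul_smul_comm, pow_succ' a n]
    module

/-- Truncated form of the commutator formula in `HasQExp.cartan`. -/
theorem qExpSum_cartan {p : ℂ} (hp : ‖p‖ < 1) {a b k f : A} {μ : ℂ}
    (hb : b * a = p • (a * b)) (hk : a * k = p • (k * a))
    (hf : f * a - a * f = μ • (k - b)) (n : ℕ) :
    f * qExpSum p a (n + 1) - qExpSum p a (n + 1) * f
      = μ • (k * qExpSum p a n - qExpSum p a n * b) := by
  have hak : ∀ n, a ^ n * k = p ^ n • (k * a ^ n) := by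
    intro n
    induction n with
    | zero => simp
    | succ n ih =>
      rw [pow_succ', mul_assoc, ih, mul_smul_comm, ← mul_assoc, hk, smul_mul_assoc, smul_smul,
        mul_assoc, pow_succ]
  -- the commutator with a power: the terms of the Leibniz sum form geometric series in `p`
  have hpow : ∀ n, (1 - p) • (f * a ^ (n + 1) - a ^ (n + 1) * f)
      = (μ * (1 - p ^ (n + 1))) • (k * a ^ n - a ^ n * b) := by
    intro n
    induction n with
    | zero => simp only [zero_add, pow_one, pow_zero, hf, mul_one, one_mul, smul_smul, mul_comm]
    | succ n ih =>
      have e : (1 - p) • (f * a ^ (n + 1 + 1) - a ^ (n + 1 + 1) * f)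
          = ((1 - p) • (f * a ^ (n + 1) - a ^ (n + 1) * f)) * a
            + (1 - p) • (a ^ (n + 1) * (f * a - a * f)) := by
        simp only [sub_mul, mul_sub, smul_mul_assoc, pow_succ _ (n + 1), mul_assoc]
        module
      rw [e, ih, hf]
      have h1 : a ^ n * b * a = p • (a ^ (n + 1) * b) := by
        rw [mul_assoc, hb, mul_smul_comm, pow_succ, mul_assoc]
      have h2 : k * a ^ n * a = k * a ^ (n + 1) := by rw [mul_assoc, pow_succ]
      rw [smul_mul_assoc, sub_mul, h1, h2, mul_smul_comm, mul_sub (a ^ (n + 1)), hak (n + 1)]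
      module
  have h1p := one_sub_ne_zero_of_norm hp
  have hterm : ∀ n, (qFact p (n + 1))⁻¹ • (f * a ^ (n + 1) - a ^ (n + 1) * f)
      = (μ * (qFact p n)⁻¹) • (k * a ^ n - a ^ n * b) := by
    intro n
    have e : f * a ^ (n + 1) - a ^ (n + 1) * f
        = ((1 - p)⁻¹ * (μ * (1 - p ^ (n + 1)))) • (k * a ^ n - a ^ n * b) := by
      rw [← smul_smul, ← hpow n, smul_smul, inv_mul_cancel₀ h1p, one_smul]
    rw [e, smul_smul]
    congr 1
    have := qFact_succ_inv hp n
    calc _ = (1 - p)⁻¹ * μ * ((1 - p ^ (n + 1)) * (qFact p (n + 1))⁻¹) := by ring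
      _ = _ := by rw [this]; field_simp
  induction n with
  | zero => simp [qExpSum]
  | succ n ih =>
    have e : f * qExpSum p a (n + 1 + 1) - qExpSum p a (n + 1 + 1) * f
        = (f * qExpSum p a (n + 1) - qExpSum p a (n + 1) * f)
          + (qFact p (n + 1))⁻¹ • (f * a ^ (n + 1) - a ^ (n + 1) * f) := by
      rw [qExpSum_succ _ _ (n + 1)]
      simp only [mul_add, add_mul, mul_smul_comm, smul_mul_assoc]
      module
    rw [e, ih, hterm, qExpSum_succ _ _ n]
    simp only [mul_add, add_mul, mul_smul_comm, smul_mul_assoc]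
    module

end PartialSums

section Limits

variable {A : Type*} [Ring A] [Algebra ℂ A] [TopologicalSpace A] [IsSemitopologicalRing A]

theorem HasQExp.const_mul {p : ℂ} {a X : A} (hX : HasQExp p a X) (y : A) :
    Tendsto (fun n => y * qExpSum p a n) atTop (𝓝 (y * X)) :=
  ((continuous_const_mul y).tendsto X).comp (show Tendsto (qExpSum p a) atTop (𝓝 X) from hX)

theorem HasQExp.mul_const {p : ℂ} {a X : A} (hX : HasQExp p a X) (y : A) :
    Tendsto (fun n => qExpSum p a n * y) atTop (𝓝 (X * y)) :=
  ((continuous_mul_const y).tendsto X).comp (show Tendsto (qExpSum p a) atTop (𝓝 X) from hX)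

theorem HasQExp.conj {p : ℂ} {a X : A} (hX : HasQExp p a X) (W : Aˣ) :
    HasQExp p (↑W⁻¹ * a * W) (↑W⁻¹ * X * W) := by
  refine (((continuous_mul_const (W : A)).tendsto _).comp (hX.const_mul (↑W⁻¹ : A))).congr
    fun n => ?_
  have := qExpSum_semiconj (p := p) (a := a) (a' := ↑W⁻¹ * a * W) (y := (↑W⁻¹ : A))
    (by rw [mul_assoc _ (W : A), Units.mul_inv, mul_one]) n
  simp only [Function.comp, this, mul_assoc, Units.inv_mul, mul_one]
  rfl

/-- In an algebra with separately continuous multiplication, a scalar acts as left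
multiplication by a fixed element, so that no continuity of the scalar action is needed. -/
theorem tendsto_const_smul_of_semitopological (c : ℂ) {u : ℕ → A} {x : A}
    (hu : Tendsto u atTop (𝓝 x)) : Tendsto (fun n => c • u n) atTop (𝓝 (c • x)) := by
  simp only [Algebra.smul_def]
  exact ((continuous_const_mul _).tendsto x).comp hu

variable [T2Space A]

theorem HasQExp.commute {p : ℂ} {a X c : A} (hX : HasQExp p a X) (hc : Commute c a) :
    Commute c X :=
  tendsto_nhds_unique (hX.const_mul c)
    ((hX.mul_const c).congr fun n => (qExpSum_semiconj hc.eq n).symm)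

/-- The `p`-difference equation `exp_p(p a) = (1 - (1 - p) a) exp_p(a)`, read as the conjugation
of an element `b` which `p`-commutes with `a`. -/
theorem HasQExp.qcomm {p : ℂ} (hp : ‖p‖ < 1) {a b X : A} (hX : HasQExp p a X)
    (hb : b * a = p • (a * b)) : b * X = X * b - (1 - p) • (a * X * b) := by
  refine tendsto_nhds_unique ((hX.const_mul b).comp (tendsto_add_atTop_nat 1)) ?_
  refine Tendsto.congr (fun n => (qExpSum_qcomm hp hb n).symm) ?_
  refine ((hX.mul_const b).comp (tendsto_add_atTop_nat 1)).sub
    (tendsto_const_smul_of_semitopological _ ?_)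
  exact ((continuous_mul_const b).tendsto _).comp (hX.const_mul a)

/-- Commutator of `exp_p(a)` with an element `f` for which `[f, a]` is the difference of two
elements `k`, `b` that `p`-commute with `a` in opposite directions. -/
theorem HasQExp.cartan {p : ℂ} (hp : ‖p‖ < 1) {a b k f X : A} {μ : ℂ} (hX : HasQExp p a X)
    (hb : b * a = p • (a * b)) (hk : a * k = p • (k * a)) (hf : f * a - a * f = μ • (k - b)) :
    f * X - X * f = μ • (k * X - X * b) := by
  refine tendsto_nhds_unique (((hX.const_mul f).sub (hX.mul_const f)).comp
    (tendsto_add_atTop_nat 1)) ?_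
  refine Tendsto.congr (fun n => (qExpSum_cartan hp hb hk hf n).symm) ?_
  exact tendsto_const_smul_of_semitopological _ ((hX.const_mul k).sub (hX.mul_const b))

end Limits

/-! ### Commutation relations of an operator with a Borel subalgebra -/

section Algebraic

variable {A : Type*} [Ring A] [Algebra ℂ A]

/-- From the commutation of `Ψ` with `a = E k` to its commutation with `k`. The element `T` stands
for `c E + ε₋ k⁻¹`; being invertible, it may be cancelled on the left. -/
theorem cartan_relation {T Ψ a k : A} {q S εp εm c : ℂ} (hTu : IsUnit T)
    (hTk : T * k = c • a + εm • (1 : A)) (hTΨ : T * Ψ = Ψ * T)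
    (hR : (εp • (1 : A) + (q * S⁻¹) • T) * (a * Ψ) = (εp • (1 : A) + (q * S) • T) * (Ψ * a)) :
    (q * c) • (S • (Ψ * a) - S⁻¹ • (a * Ψ)) = εp • (k * Ψ - Ψ * k) := by
  refine hTu.mul_left_cancel ?_
  have e1 : T * (k * Ψ - Ψ * k) = c • (a * Ψ - Ψ * a) := by
    rw [mul_sub, ← mul_assoc, ← mul_assoc, hTk, hTΨ, mul_assoc, hTk]
    simp only [add_mul, mul_add, smul_mul_assoc, mul_smul_comm, one_mul, mul_one]
    module
  have e2 : (q * S) • (T * (Ψ * a)) - (q * S⁻¹) • (T * (a * Ψ)) = εp • (a * Ψ - Ψ * a) := by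
    simp only [add_mul, smul_mul_assoc, one_mul] at hR
    linear_combination (norm := module) (-1 : ℂ) • hR
  rw [mul_smul_comm, mul_smul_comm, e1, smul_comm εp, ← e2]
  simp only [mul_sub, mul_smul_comm]
  module

/-- A relation between `Ψ`, `a = E k` and `k` in which the coefficient `c` of the off-diagonal entry
does not occur, so that it has content also for `c = 0`. -/
theorem diagonal_relation {T Ψ a k : A} {q S εp εm c : ℂ} (hTu : IsUnit T)
    (hTk : T * k = c • a + εm • (1 : A)) (haT : a * T = (q ^ 2) • (T * a))
    (hTΨ : T * Ψ = Ψ * T)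
    (hR : (εp • (1 : A) + (q * S⁻¹) • T) * (a * Ψ) = (εp • (1 : A) + (q * S) • T) * (Ψ * a)) :
    εp • ((q ^ 2) • (a * Ψ * k) - k * Ψ * a) = (q * εm) • (S • (Ψ * a) - S⁻¹ • (a * Ψ)) := by
  refine hTu.mul_left_cancel ?_
  have e1 : T * ((q ^ 2) • (a * Ψ * k) - k * Ψ * a) = εm • (a * Ψ - Ψ * a) := by
    have h1 : T * ((q ^ 2) • (a * Ψ * k)) = a * Ψ * (T * k) := by
      rw [mul_smul_comm, ← mul_assoc, ← mul_assoc, ← smul_mul_assoc, ← smul_mul_assoc, ← haT,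
        mul_assoc a T, hTΨ]
      simp only [mul_assoc]
    have h2 : T * (k * Ψ * a) = (T * k) * (Ψ * a) := by simp only [mul_assoc]
    rw [mul_sub, h1, h2, hTk]
    simp only [add_mul, mul_add, smul_mul_assoc, mul_smul_comm, one_mul, mul_one, mul_assoc]
    module
  have e2 : (q * S) • (T * (Ψ * a)) - (q * S⁻¹) • (T * (a * Ψ)) = εp • (a * Ψ - Ψ * a) := by
    simp only [add_mul, smul_mul_assoc, one_mul] at hR
    linear_combination (norm := module) (-1 : ℂ) • hR
  rw [mul_smul_comm, mul_smul_comm, e1, smul_comm εp, ← e2]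
  simp only [mul_sub, mul_smul_comm]
  module

/-- The relation between `Ψ` and the opposite root vector `F`.  The element
`V = F k⁻¹ + γ k⁻¹ - γ ε₋ T⁻¹` raises `T` by one step, so that `F` is a raising element up to
terms in `k` and `T` only. -/
theorem opposite_relation {T t Ψ a k b F V : A} {q S εp εm c γ : ℂ} (hS : S ≠ 0)
    (hkb : k * b = 1) (hbk : b * k = 1) (hkF : F * k = (q ^ 2) • (k * F))
    (hTk : T * k = c • a + εm • (1 : A)) (hkT : k * T = (q ^ 2 * c) • a + εm • (1 : A))
    (hTt : T * t = 1) (htT : t * T = 1) (hTΨ : T * Ψ = Ψ * T)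
    (hV : V = F * b + γ • b - (γ * εm) • t)
    (hRV : V * Ψ * (εp • (1 : A) + (q * S) • T) = (εp • (1 : A) + (q⁻¹ * S⁻¹) • T) * Ψ * V)
    (hcart : (q * c) • (S • (Ψ * a) - S⁻¹ • (a * Ψ)) = εp • (k * Ψ - Ψ * k)) :
    F * Ψ * (εp • (1 : A) + (q * S) • T) * k
      - (q ^ 2) • (k * (εp • (1 : A) + (q⁻¹ * S⁻¹) • T) * Ψ * F)
      = (q * γ * εm * (q ^ 2 * S - S⁻¹)) • (k * Ψ * k - (1 : A) * Ψ) := by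
  have htΨ : t * Ψ = Ψ * t := by
    calc t * Ψ = t * (Ψ * T) * t := by rw [mul_assoc, mul_assoc, hTt, mul_one]
      _ = Ψ * t := by rw [← hTΨ, ← mul_assoc, htT, one_mul]
  have hF1 : F = V * k - γ • (1 : A) + (γ * εm) • (t * k) := by
    rw [hV]
    simp only [sub_mul, add_mul, smul_mul_assoc, mul_assoc, hbk, mul_one]
    module
  have hF2 : F = (q ^ 2) • (k * V - γ • (1 : A) + (γ * εm) • (k * t)) := by
    have e : (q ^ 2) • (k * (F * b)) = F := by
      rw [← mul_assoc, ← smul_mul_assoc, ← hkF, mul_assoc, hkb, mul_one]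
    rw [hV]
    simp only [mul_sub, mul_add, mul_smul_comm, hkb]
    nth_rewrite 1 [← e]
    module
  have e1 : F * Ψ * (εp • (1 : A) + (q * S) • T) * k
      = (q ^ 2) • (k * (V * Ψ * (εp • (1 : A) + (q * S) • T)) * k)
        - (q ^ 2 * γ) • (Ψ * (εp • k + (q * S) • (T * k)))
        + (q ^ 2 * γ * εm) • (εp • (k * Ψ * t * k) + (q * S) • (k * Ψ * k)) := by
    have ht : k * t * Ψ * (εp • (1 : A) + (q * S) • T) * k
        = εp • (k * Ψ * t * k) + (q * S) • (k * Ψ * k) := by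
      rw [mul_assoc k, htΨ]
      simp only [mul_add, add_mul, mul_smul_comm, smul_mul_assoc, mul_one, mul_assoc]
      rw [← mul_assoc t T k, htT, one_mul]
    rw [← ht]
    nth_rewrite 1 [hF2]
    simp only [mul_add, add_mul, sub_mul, mul_smul_comm, smul_mul_assoc, mul_one, one_mul,
      mul_assoc]
    module
  have e2 : k * (εp • (1 : A) + (q⁻¹ * S⁻¹) • T) * Ψ * F
      = k * ((εp • (1 : A) + (q⁻¹ * S⁻¹) • T) * Ψ * V) * k
        - γ • ((εp • k + (q⁻¹ * S⁻¹) • (k * T)) * Ψ)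
        + (γ * εm) • (εp • (k * Ψ * t * k) + (q⁻¹ * S⁻¹) • (k * Ψ * k)) := by
    have ht : k * (εp • (1 : A) + (q⁻¹ * S⁻¹) • T) * Ψ * (t * k)
        = εp • (k * Ψ * t * k) + (q⁻¹ * S⁻¹) • (k * Ψ * k) := by
      simp only [mul_add, add_mul, mul_smul_comm, smul_mul_assoc, mul_one, mul_assoc]
      rw [← mul_assoc T Ψ, hTΨ, mul_assoc, ← mul_assoc T t, hTt, one_mul]
    rw [← ht]
    nth_rewrite 1 [hF1]
    simp only [mul_add, add_mul, mul_sub, mul_smul_comm, smul_mul_assoc, mul_one, one_mul,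
      mul_assoc]
  rw [e1, e2, hRV, hTk, hkT]
  simp only [mul_add, add_mul, mul_smul_comm, smul_mul_assoc, mul_one, one_mul]
  simp only [smul_sub, smul_smul] at hcart
  linear_combination (norm := skip) (-(q ^ 2 * γ)) • hcart
  match_scalars <;> field_simp <;> ring

end Algebraic

/-! ### The reflection equation for a triangular scalar K-matrix -/

theorem qq_ne_zero (h : ℂ) : qq h ≠ 0 := Complex.exp_ne_zero h

theorem qpow_ne_zero (h u : ℂ) : qpow h u ≠ 0 := Complex.exp_ne_zero _

section Reflection

variable {A : Type*} [Ring A] [Algebra ℂ A]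

/-- The reflection equation for an upper triangular scalar K-matrix. Here `g`, `g'` stand for
`q ^ (±H/2)`, and `x0`, `x1`, `y0`, `y1` for `x ^ s₀`, `x ^ s₁`, `y ^ s₀`, `y ^ s₁`; treating these
as independent makes the coefficients rational functions. The hypotheses are free of
`y0`, `y1`: the lower left entry is a multiple of `h1`, the upper right one of `h4`, and the
diagonal ones are combinations of `h2` and `h3`. -/
theorem reflection_of_relations (g g' E F K : A) {q l x0 x1 y0 y1 εp εm kp : ℂ} (hq : q ≠ 0)
    (hl : l ≠ 0) (hx0 : x0 ≠ 0) (hx1 : x1 ≠ 0) (hy0 : y0 ≠ 0) (hy1 : y1 ≠ 0)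
    (h1 : εp • (x1⁻¹ • (E * g * K * g) - (q⁻¹ * x0⁻¹ * (x0 * x1)⁻¹) • (g * K * (E * g)))
      = εm • (x0⁻¹ • (g' * K * (E * g)) - (q⁻¹ * x1⁻¹ * (x0 * x1)⁻¹) • (E * g * K * g')))
    (h2 : kp • (x1⁻¹ • (E * g * K * g) - (q⁻¹ * x0⁻¹ * (x0 * x1)⁻¹) • (g * K * (E * g)))
      = (εm * q⁻¹ * (x0 * x1)⁻¹) • (g * K * g' - g' * K * g))
    (h3 : kp • (x0⁻¹ • (g' * K * (E * g)) - (q⁻¹ * x1⁻¹ * (x0 * x1)⁻¹) • (E * g * K * g'))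
      = (εp * q⁻¹ * (x0 * x1)⁻¹) • (g * K * g' - g' * K * g))
    (h4 : kp • ((x0⁻¹ ^ 2) • (F * g' * K * (E * g)) - (x1⁻¹ ^ 2) • (E * g * K * (F * g'))
        + (l⁻¹ ^ 2 * (1 - (q⁻¹ * (x0 * x1)⁻¹) ^ 2)) • (g * K * g - g' * K * g'))
      = εp • (x1⁻¹ • (g * K * (F * g')) - (q⁻¹ * x0⁻¹ * (x0 * x1)⁻¹) • (F * g' * K * g))
        - εm • (x0⁻¹ • (F * g' * K * g') - (q⁻¹ * x1⁻¹ * (x0 * x1)⁻¹) • (g' * K * (F * g')))) :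
    !![g - (q⁻¹ * (y0 / x0 * (y1 / x1))) • g', (l * (y0 / x0)) • (F * g');
        (l * (y1 / x1)) • (E * g), g' - (q⁻¹ * (y0 / x0 * (y1 / x1))) • g]
      * Matrix.diagonal (fun _ => K)
      * !![g - (q⁻¹ * (x0 * y0 * (x1 * y1))⁻¹) • g', (l * (x1 * y1)⁻¹) • (F * g');
        (l * (x0 * y0)⁻¹) • (E * g), g' - (q⁻¹ * (x0 * y0 * (x1 * y1))⁻¹) • g]
      * !![algebraMap ℂ A (y0 * εp + y1⁻¹ * εm), algebraMap ℂ A (kp * (y0 * y1 - (y0 * y1)⁻¹) / l);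
        0, algebraMap ℂ A (y0⁻¹ * εp + y1 * εm)]
    = !![algebraMap ℂ A (y0 * εp + y1⁻¹ * εm), algebraMap ℂ A (kp * (y0 * y1 - (y0 * y1)⁻¹) / l);
        0, algebraMap ℂ A (y0⁻¹ * εp + y1 * εm)]
      * !![g - (q⁻¹ * (x0 * y0 * (x1 * y1))⁻¹) • g', (l * (x0 * y0)⁻¹) • (F * g');
        (l * (x1 * y1)⁻¹) • (E * g), g' - (q⁻¹ * (x0 * y0 * (x1 * y1))⁻¹) • g]
      * Matrix.diagonal (fun _ => K)
      * !![g - (q⁻¹ * (x0 / y0 * (x1 / y1))⁻¹) • g', (l * (x1 / y1)⁻¹) • (F * g');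
        (l * (x0 / y0)⁻¹) • (E * g), g' - (q⁻¹ * (x0 / y0 * (x1 / y1))⁻¹) • g] := by
  ext i j
  fin_cases i <;> fin_cases j <;>
    simp only [Matrix.mul_apply, Fin.sum_univ_two, Matrix.diagonal_apply, Matrix.of_apply,
      Fin.zero_eta, Fin.mk_one, Matrix.cons_val_zero, Matrix.cons_val_one, Matrix.cons_val',
      Matrix.cons_val_fin_one, Fin.isValue, reduceIte, mul_zero, zero_mul, add_zero, zero_add,
      zero_ne_one, one_ne_zero, Algebra.algebraMap_eq_smul_one]
  all_goals
    simp only [mul_assoc] at h1 h2 h3 h4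
    simp only [add_mul, sub_mul, mul_sub, smul_mul_assoc, mul_smul_comm, mul_one,
      one_mul, mul_assoc]
  · linear_combination (norm := skip) (-(y0 * y1 - (y0 * y1)⁻¹) * y1⁻¹) • h2
      - ((y0 * y1 - (y0 * y1)⁻¹) * y0) • h3
    match_scalars <;> field_simp <;> ring
  · linear_combination (norm := skip) ((y0 * y1 - (y0 * y1)⁻¹) * l) • h4
    match_scalars <;> field_simp <;> ring
  · linear_combination (norm := skip) ((y0 * y1 - (y0 * y1)⁻¹) * l) • h1
    match_scalars <;> field_simp <;> ring
  · linear_combination (norm := skip) ((y0 * y1 - (y0 * y1)⁻¹) * y1) • h2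
      + ((y0 * y1 - (y0 * y1)⁻¹) * y0⁻¹) • h3
    match_scalars <;> field_simp <;> ring

set_option linter.unusedSimpArgs false in
/-- The hypotheses of `reflection_of_relations` for `K = Z Ψ`, where `Z` stands for
`x ^ (s₀ H)`. Each of the four is one relation of `Ψ` multiplied from both sides by group-like
elements; the commutation rules bring both sides to the same normal form. -/
theorem relations_of_dressed {g g' Z E F Ψ : A} {q l x0 x1 εp εm c γ : ℂ} (hq : q ≠ 0)
    (hl : l ≠ 0) (hx0 : x0 ≠ 0) (hx1 : x1 ≠ 0) (hγ : q * γ * εm = -(c * l⁻¹ ^ 2))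
    (hgg : g * g' = 1) (hgg' : g' * g = 1)
    (hgE : g * E = q • (E * g)) (hgE' : g' * E = q⁻¹ • (E * g'))
    (hgF : g * F = q⁻¹ • (F * g)) (hgF' : g' * F = q • (F * g'))
    (hZg : Z * g = g * Z) (hZg' : Z * g' = g' * Z)
    (hZE : Z * E = (x0 ^ 2) • (E * Z)) (hZF : Z * F = (x0⁻¹ ^ 2) • (F * Z))
    (hA : c • (E * Ψ - Ψ * E) = εm • (Ψ * (g' * g') - g' * g' * Ψ))
    (hB : εp • ((q ^ 2) • (E * (g * g) * Ψ * (g * g)) - g * g * Ψ * (E * (g * g)))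
      = (q * εm) • ((x0 * x1) • (Ψ * (E * (g * g))) - (x0 * x1)⁻¹ • (E * (g * g) * Ψ)))
    (hC : (q * c) • ((x0 * x1) • (Ψ * (E * (g * g))) - (x0 * x1)⁻¹ • (E * (g * g) * Ψ))
      = εp • (g * g * Ψ - Ψ * (g * g)))
    (hD : F * Ψ * (εp • (1 : A) + (q * (x0 * x1)) • (c • E + εm • (g' * g'))) * (g * g)
      - (q ^ 2) • (g * g * (εp • (1 : A) + (q⁻¹ * (x0 * x1)⁻¹) • (c • E + εm • (g' * g')))
          * Ψ * F)
      = (q * γ * εm * (q ^ 2 * (x0 * x1) - (x0 * x1)⁻¹)) • (g * g * Ψ * (g * g) - (1 : A) * Ψ)) :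
    (εp • (x1⁻¹ • (E * g * (Z * Ψ) * g)
          - (q⁻¹ * x0⁻¹ * (x0 * x1)⁻¹) • (g * (Z * Ψ) * (E * g)))
      = εm • (x0⁻¹ • (g' * (Z * Ψ) * (E * g))
          - (q⁻¹ * x1⁻¹ * (x0 * x1)⁻¹) • (E * g * (Z * Ψ) * g')))
    ∧ ((x0 * c) • (x1⁻¹ • (E * g * (Z * Ψ) * g)
          - (q⁻¹ * x0⁻¹ * (x0 * x1)⁻¹) • (g * (Z * Ψ) * (E * g)))
      = (εm * q⁻¹ * (x0 * x1)⁻¹) • (g * (Z * Ψ) * g' - g' * (Z * Ψ) * g))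
    ∧ ((x0 * c) • (x0⁻¹ • (g' * (Z * Ψ) * (E * g))
          - (q⁻¹ * x1⁻¹ * (x0 * x1)⁻¹) • (E * g * (Z * Ψ) * g'))
      = (εp * q⁻¹ * (x0 * x1)⁻¹) • (g * (Z * Ψ) * g' - g' * (Z * Ψ) * g))
    ∧ ((x0 * c) • ((x0⁻¹ ^ 2) • (F * g' * (Z * Ψ) * (E * g))
          - (x1⁻¹ ^ 2) • (E * g * (Z * Ψ) * (F * g'))
        + (l⁻¹ ^ 2 * (1 - (q⁻¹ * (x0 * x1)⁻¹) ^ 2))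
          • (g * (Z * Ψ) * g - g' * (Z * Ψ) * g'))
      = εp • (x1⁻¹ • (g * (Z * Ψ) * (F * g'))
          - (q⁻¹ * x0⁻¹ * (x0 * x1)⁻¹) • (F * g' * (Z * Ψ) * g))
        - εm • (x0⁻¹ • (F * g' * (Z * Ψ) * g')
          - (q⁻¹ * x1⁻¹ * (x0 * x1)⁻¹) • (g' * (Z * Ψ) * (F * g')))) := by
  -- moving letters past each other inside longer words
  have assoc {x y w : A} {r : ℂ} (hr : x * y = r • w) (v : A) : x * (y * v) = r • (w * v) := by
    rw [← mul_assoc, hr, smul_mul_assoc]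
  have agg (v : A) : g * (g' * v) = v := by rw [← mul_assoc, hgg, one_mul]
  have agg' (v : A) : g' * (g * v) = v := by rw [← mul_assoc, hgg', one_mul]
  have agE := assoc hgE
  have agE' := assoc hgE'
  have agF := assoc hgF
  have agF' := assoc hgF'
  have aZE := assoc hZE
  have aZF := assoc hZF
  have aZg (v : A) : Z * (g * v) = g * (Z * v) := by rw [← mul_assoc, hZg, mul_assoc]
  have aZg' (v : A) : Z * (g' * v) = g' * (Z * v) := by rw [← mul_assoc, hZg', mul_assoc]
  rw [hγ] at hD
  refine ⟨?_, ?_, ?_, ?_⟩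
  · have e := congrArg (fun t => (x0⁻¹ * q⁻¹ * (x0 * x1)⁻¹) • (Z * g' * t * g')) hB
    simp only [add_mul, sub_mul, mul_add, mul_sub, smul_mul_assoc, mul_smul_comm, mul_one,
      one_mul, mul_assoc, agg, agg', agE, agE', agF, agF', aZE, aZF, aZg, aZg', hgg, hgg', hgE,
      hgE', hgF, hgF', hZE, hZF, hZg, hZg'] at e ⊢
    linear_combination (norm := skip) e
    match_scalars <;> field_simp <;> ring
  · have e := congrArg (fun t => (q⁻¹ * (x0 * x1)⁻¹) • (Z * g * t * g)) hA
    simp only [add_mul, sub_mul, mul_add, mul_sub, smul_mul_assoc, mul_smul_comm, mul_one,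
      one_mul, mul_assoc, agg, agg', agE, agE', agF, agF', aZE, aZF, aZg, aZg', hgg, hgg', hgE,
      hgE', hgF, hgF', hZE, hZF, hZg, hZg'] at e ⊢
    linear_combination (norm := skip) e
    match_scalars <;> field_simp <;> ring
  · have e := congrArg (fun t => (q⁻¹ * (x0 * x1)⁻¹) • (Z * g' * t * g')) hC
    simp only [add_mul, sub_mul, mul_add, mul_sub, smul_mul_assoc, mul_smul_comm, mul_one,
      one_mul, mul_assoc, agg, agg', agE, agE', agF, agF', aZE, aZF, aZg, aZg', hgg, hgg', hgE,
      hgE', hgF, hgF', hZE, hZF, hZg, hZg'] at e ⊢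
    linear_combination (norm := skip) e
    match_scalars <;> field_simp <;> ring
  · have e := congrArg (fun t => (x0 * q⁻¹ ^ 2 * (x0 * x1)⁻¹) • (Z * g' * t * g')) hD
    simp only [add_mul, sub_mul, mul_add, mul_sub, smul_mul_assoc, mul_smul_comm, mul_one,
      one_mul, mul_assoc, agg, agg', agE, agE', agF, agF', aZE, aZF, aZg, aZg', hgg, hgg', hgE,
      hgE', hgF, hgF', hZE, hZF, hZg, hZg'] at e ⊢
    linear_combination (norm := skip) e
    match_scalars <;> field_simp <;> ring

end Reflection

/-! ### Dressing a ratio of shifted factorials by a `p`-exponential -/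

section Dressing

variable {A : Type*} [Ring A] [Algebra ℂ A]

/-- Conjugation `y ↦ X⁻¹ y X` by a unit, as an algebra homomorphism. -/
def conjHom (X : Aˣ) : A →ₐ[ℂ] A where
  toFun y := ↑X⁻¹ * y * X
  map_one' := by simp
  map_mul' y z := by
    rw [mul_assoc (↑X⁻¹ * y) (X : A), mul_assoc (↑X⁻¹ : A) z, ← mul_assoc (X : A),
      Units.mul_inv, one_mul]
    simp only [mul_assoc]
  map_zero' := by simp
  map_add' y z := by simp only [mul_add, add_mul]
  commutes' r := by rw [← Algebra.commutes, mul_assoc, Units.inv_mul, mul_one]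

theorem conjHom_apply (X : Aˣ) (y : A) : conjHom X y = ↑X⁻¹ * y * X := rfl

theorem conjHom_eq_iff (X : Aˣ) (y z : A) : conjHom X y = z ↔ y * X = X * z := by
  rw [conjHom_apply, mul_assoc, Units.inv_mul_eq_iff_eq_mul]

variable [TopologicalSpace A] [IsSemitopologicalRing A] [T2Space A]

theorem HasQPoch.commute_self {p : ℂ} {w N : A} (hN : HasQPoch p w N) : Commute w N :=
  hN.commute (Commute.refl w)

/-- A ratio of shifted factorials passed through an element which lowers the argument. -/
theorem ratio_lower {p : ℂ} {w v N y : A} {D : Aˣ} (hN : HasQPoch p w N)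
    (hD : HasQPoch p v (D : A)) (hwv : Commute w v)
    (hw : w * y = p • (y * w)) (hv : v * y = p • (y * v)) :
    y * (N * ↑D⁻¹) * (1 - v) = N * ↑D⁻¹ * y * (1 - w) := by
  have hwD : Commute w ↑D⁻¹ := (hD.commute hwv).units_inv_right
  have hvD : Commute v ↑D⁻¹ := hD.commute_self.units_inv_right
  have e1 : (↑D⁻¹ : A) * y = y * (1 - v) * ↑D⁻¹ := by
    rw [Units.inv_mul_eq_iff_eq_mul, ← mul_assoc, ← mul_assoc, hD.lower hv, mul_assoc,
      Units.mul_inv, mul_one]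
  have c1 : Commute (1 - v) (↑D⁻¹ : A) := (Commute.one_left _).sub_left hvD
  have c2 : Commute (1 - w) (↑D⁻¹ : A) := (Commute.one_left _).sub_left hwD
  have c3 : Commute (1 - w) (1 - v) :=
    (Commute.one_left _).sub_left ((Commute.one_right _).sub_right hwv)
  calc y * (N * ↑D⁻¹) * (1 - v) = y * N * (↑D⁻¹ * (1 - v)) := by simp only [mul_assoc]
    _ = N * y * (1 - w) * ((1 - v) * ↑D⁻¹) := by rw [← hN.lower hw, c1.eq]
    _ = N * y * ((1 - w) * (1 - v)) * ↑D⁻¹ := by simp only [mul_assoc]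
    _ = N * y * (1 - v) * ((1 - w) * ↑D⁻¹) := by rw [c3.eq]; simp only [mul_assoc]
    _ = N * (y * (1 - v) * ↑D⁻¹) * (1 - w) := by rw [c2.eq]; simp only [mul_assoc]
    _ = N * ↑D⁻¹ * y * (1 - w) := by rw [← e1]; simp only [mul_assoc]

/-- A ratio of shifted factorials passed through an element which raises the argument. -/
theorem ratio_raise {p : ℂ} {w v N f : A} {D : Aˣ} (hN : HasQPoch p w N)
    (hD : HasQPoch p v (D : A)) (hwv : Commute w v)
    (hw : f * w = p • (w * f)) (hv : f * v = p • (v * f)) :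
    (1 - w) * (f * (N * ↑D⁻¹)) = (1 - v) * (N * ↑D⁻¹) * f := by
  have hvD : Commute v ↑D⁻¹ := hD.commute_self.units_inv_right
  have hvN : Commute v N := hN.commute hwv.symm
  have e1 : f * (↑D⁻¹ : A) = ↑D⁻¹ * (1 - v) * f := by
    rw [mul_assoc, ← Units.mul_left_inj D, mul_assoc, Units.inv_mul, mul_one, mul_assoc,
      mul_assoc, hD.raise hv, Units.inv_mul_cancel_left]
  have c1 : Commute (1 - v) (N * (↑D⁻¹ : A)) :=
    (Commute.one_left _).sub_left (hvN.mul_right hvD)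
  calc (1 - w) * (f * (N * ↑D⁻¹)) = (1 - w) * (f * N) * ↑D⁻¹ := by simp only [mul_assoc]
    _ = N * (f * ↑D⁻¹) := by rw [hN.raise hw]; simp only [mul_assoc]
    _ = N * ↑D⁻¹ * (1 - v) * f := by rw [e1]; simp only [mul_assoc]
    _ = (1 - v) * (N * ↑D⁻¹) * f := by rw [c1.eq]

/-- Conjugation by `exp_p(α E k)` turns the group-like element `b = k⁻¹` into a multiple of the
coideal element `c E + ε₋ b`. -/
theorem conjHom_cartan {q l c εm : ℂ} (hp : ‖(q ^ 2)⁻¹‖ < 1) (hq : q ≠ 0) (hl : l = q - q⁻¹)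
    (hl0 : l ≠ 0) (hεm : εm ≠ 0) {E k b : A} {X : Aˣ} (hkb : k * b = 1)
    (hba : b * (E * k) = (q ^ 2)⁻¹ • (E * k * b))
    (hX : HasQExp (q ^ 2)⁻¹ ((-(q * c) / (l * εm)) • (E * k)) (X : A)) :
    conjHom X b = εm⁻¹ • (c • E + εm • b) := by
  have hbB : b * ((-(q * c) / (l * εm)) • (E * k))
      = (q ^ 2)⁻¹ • ((-(q * c) / (l * εm)) • (E * k) * b) := by
    rw [mul_smul_comm, hba, smul_mul_assoc, smul_comm]
  have hXB := hX.commute (Commute.refl _)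
  have hEk : E * k * b = E := by rw [mul_assoc, hkb, mul_one]
  -- the difference equation contributes the factor `1 - q⁻² = q⁻¹ (q - q⁻¹)`
  have hcoef : (1 - (q ^ 2)⁻¹) * (-(q * c) / (l * εm)) = -(εm⁻¹ * c) := by
    have : 1 - (q ^ 2)⁻¹ = q⁻¹ * l := by rw [hl]; field_simp
    rw [this]; field_simp
  rw [conjHom_eq_iff, hX.qcomm hp hbB, hXB.eq, mul_assoc, smul_mul_assoc, hEk, mul_smul_comm,
    smul_smul, hcoef, smul_add, smul_smul, smul_smul, inv_mul_cancel₀ hεm, mul_add,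
    mul_smul_comm, mul_smul_comm]
  module

/-- Conjugation by `exp_p(α E k)` of the opposite root vector, in the form `F b`, which
`p`-commutes with `b`. -/
theorem conjHom_opposite {q l c εm : ℂ} (hp : ‖(q ^ 2)⁻¹‖ < 1) {E F k b : A} {X : Aˣ}
    (hba : b * (E * k) = (q ^ 2)⁻¹ • (E * k * b))
    (hak : E * k * k = (q ^ 2)⁻¹ • (k * (E * k)))
    (hFa : F * b * (E * k) - E * k * (F * b) = -((q ^ 2)⁻¹ * l⁻¹) • (k - b))
    (hX : HasQExp (q ^ 2)⁻¹ ((-(q * c) / (l * εm)) • (E * k)) (X : A)) :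
    conjHom X (F * b) = F * b + ((q ^ 2)⁻¹ * (-(q * c) / (l * εm)) * l⁻¹) • b
      - ((q ^ 2)⁻¹ * (-(q * c) / (l * εm)) * l⁻¹) • conjHom X k := by
  set α := -(q * c) / (l * εm)
  have hbB : b * (α • (E * k)) = (q ^ 2)⁻¹ • (α • (E * k) * b) := by
    rw [mul_smul_comm, hba, smul_mul_assoc, smul_comm]
  have hBk : α • (E * k) * k = (q ^ 2)⁻¹ • (k * (α • (E * k))) := by
    rw [mul_smul_comm, smul_mul_assoc, hak, smul_comm]
  have hFB : F * b * (α • (E * k)) - α • (E * k) * (F * b)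
      = (-((q ^ 2)⁻¹ * α * l⁻¹)) • (k - b) := by
    rw [mul_smul_comm, smul_mul_assoc, ← smul_sub, hFa, smul_smul]
    congr 1; ring
  have e := hX.cartan hp hbB hBk hFB
  have hk : (X : A) * conjHom X k = k * X := by
    rw [conjHom_apply, mul_assoc, Units.mul_inv_cancel_left]
  rw [conjHom_eq_iff, mul_sub, mul_add, mul_smul_comm, mul_smul_comm, hk]
  linear_combination (norm := module) e

/-- The commutation relations of the dressed ratio `Ψ = X⁻¹ N D⁻¹ X`: with `T = c E + ε₋ b`, with
`E k` and `k`, and with `F`. -/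
theorem dressed_relations {q l c S εp εm : ℂ} (hp : ‖(q ^ 2)⁻¹‖ < 1) (hq : q ≠ 0)
    (hl : l = q - q⁻¹) (hl0 : l ≠ 0) (hS : S ≠ 0) (hεp : εp ≠ 0) (hεm : εm ≠ 0)
    {E F k b N : A} {X D : Aˣ} (hkb : k * b = 1) (hbk : b * k = 1)
    (hkE : k * E = (q ^ 2) • (E * k)) (hkF : F * k = (q ^ 2) • (k * F))
    (hEF : E * F - F * E = l⁻¹ • (k - b))
    (hX : HasQExp (q ^ 2)⁻¹ ((-(q * c) / (l * εm)) • (E * k)) (X : A))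
    (hN : HasQPoch (q ^ 2)⁻¹ ((-(εm / εp) * S * q⁻¹) • b) N)
    (hD : HasQPoch (q ^ 2)⁻¹ ((-(εm / εp) * S⁻¹ * q⁻¹) • b) (D : A)) :
    ∃ Ψ γ, Ψ = ↑X⁻¹ * (N * ↑D⁻¹) * X ∧ q * γ * εm = -(c * l⁻¹ ^ 2) ∧
      c • (E * Ψ - Ψ * E) = εm • (Ψ * b - b * Ψ) ∧
      εp • ((q ^ 2) • (E * k * Ψ * k) - k * Ψ * (E * k))
        = (q * εm) • (S • (Ψ * (E * k)) - S⁻¹ • (E * k * Ψ)) ∧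
      (q * c) • (S • (Ψ * (E * k)) - S⁻¹ • (E * k * Ψ)) = εp • (k * Ψ - Ψ * k) ∧
      F * Ψ * (εp • (1 : A) + (q * S) • (c • E + εm • b)) * k
        - (q ^ 2) • (k * (εp • (1 : A) + (q⁻¹ * S⁻¹) • (c • E + εm • b)) * Ψ * F)
        = (q * γ * εm * (q ^ 2 * S - S⁻¹)) • (k * Ψ * k - (1 : A) * Ψ) := by
  have hq2 : (q ^ 2)⁻¹ * q ^ 2 = 1 := inv_mul_cancel₀ (pow_ne_zero 2 hq)
  have hEb : b * E = (q ^ 2)⁻¹ • (E * b) := by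
    have e1 : b * (k * E) * b = E * b := by rw [← mul_assoc, hbk, one_mul]
    rw [hkE, mul_smul_comm, smul_mul_assoc, mul_assoc, mul_assoc, hkb, mul_one] at e1
    rw [← e1, smul_smul, hq2, one_smul]
  have hbF : b * F = (q ^ 2) • (F * b) := by
    have e1 : b * (F * k) * b = b * F := by rw [mul_assoc, mul_assoc, hkb, mul_one]
    rw [hkF, mul_smul_comm, smul_mul_assoc, ← mul_assoc, hbk, one_mul] at e1
    rw [e1]
  have hba : b * (E * k) = (q ^ 2)⁻¹ • (E * k * b) := by
    rw [← mul_assoc, hEb, smul_mul_assoc, mul_assoc, mul_assoc, hbk, hkb]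
  have hak : E * k * k = (q ^ 2)⁻¹ • (k * (E * k)) := by
    rw [← mul_assoc k, hkE, smul_mul_assoc, smul_smul, hq2, one_smul]
  have hFa : F * b * (E * k) - E * k * (F * b) = -((q ^ 2)⁻¹ * l⁻¹) • (k - b) := by
    have e1 : F * b * (E * k) = (q ^ 2)⁻¹ • (F * E) := by
      rw [mul_assoc, hba, mul_smul_comm, mul_assoc E, hkb, mul_one]
    have hkF' : k * F = (q ^ 2)⁻¹ • (F * k) := by rw [hkF, smul_smul, hq2, one_smul]
    have e2 : E * k * (F * b) = (q ^ 2)⁻¹ • (E * F) := by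
      rw [mul_assoc, ← mul_assoc k, hkF', smul_mul_assoc, mul_assoc F, hkb, mul_one,
        mul_smul_comm]
    rw [e1, e2, ← smul_sub, ← neg_sub, hEF, ← smul_neg, smul_smul, smul_neg, neg_smul]
  set T := c • E + εm • b with hT
  set γ := (q ^ 2)⁻¹ * (-(q * c) / (l * εm)) * l⁻¹ with hγ
  set Ψ := conjHom X (N * ↑D⁻¹) with hΨ
  -- the inverse of `T`
  set t := εm⁻¹ • conjHom X k with ht
  have hφb : conjHom X b = εm⁻¹ • T :=
    conjHom_cartan hp hq hl hl0 hεm hkb hba hX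
  have hTφ : T = εm • conjHom X b := by rw [hφb, smul_smul, mul_inv_cancel₀ hεm, one_smul]
  have hTt : T * t = 1 := by
    rw [hTφ, ht, smul_mul_smul_comm, mul_inv_cancel₀ hεm, ← map_mul, hbk, map_one, one_smul]
  have htT : t * T = 1 := by
    rw [hTφ, ht, smul_mul_smul_comm, inv_mul_cancel₀ hεm, ← map_mul, hkb, map_one, one_smul]
  have hTu : IsUnit T := ⟨⟨T, t, hTt, htT⟩, rfl⟩
  have hφa : conjHom X (E * k) = E * k := by
    rw [conjHom_eq_iff]
    exact (hX.commute ((Commute.refl (E * k)).smul_right _)).eq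
  have hφf : conjHom X (F * b) = F * b + γ • b - (γ * εm) • t := by
    rw [conjHom_opposite hp hba hak hFa hX, ht, smul_smul, mul_assoc γ, mul_inv_cancel₀ hεm,
      mul_one]
  have hTk : T * k = c • (E * k) + εm • (1 : A) := by
    rw [hT, add_mul, smul_mul_assoc, smul_mul_assoc, hbk]
  have hkT : k * T = (q ^ 2 * c) • (E * k) + εm • (1 : A) := by
    rw [hT, mul_add, mul_smul_comm, mul_smul_comm, hkb, hkE, smul_smul, mul_comm c]
  have haT : E * k * T = (q ^ 2) • (T * (E * k)) := by
    have e1 : b * (E * k) = (q ^ 2)⁻¹ • E := by rw [hba, mul_assoc, hkb, mul_one]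
    rw [hT, mul_add, add_mul, mul_smul_comm, mul_smul_comm, smul_mul_assoc, smul_mul_assoc, e1,
      mul_assoc, mul_assoc, hkb, hkE, mul_one, mul_smul_comm]
    match_scalars <;> field_simp
  have hbG : Commute b (N * ↑D⁻¹) :=
    (hN.commute ((Commute.refl b).smul_right _)).mul_right
      (hD.commute ((Commute.refl b).smul_right _)).units_inv_right
  have hTΨ : T * Ψ = Ψ * T := by
    rw [hTφ, smul_mul_assoc, mul_smul_comm, hΨ, ← map_mul, ← map_mul, hbG.eq]
  have hwv : Commute ((-(εm / εp) * S * q⁻¹) • b) ((-(εm / εp) * S⁻¹ * q⁻¹) • b) :=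
    ((Commute.refl b).smul_left _).smul_right _
  have hlow (r : ℂ) : r • b * (E * k) = (q ^ 2)⁻¹ • (E * k * (r • b)) := by
    rw [smul_mul_assoc, hba, mul_smul_comm, smul_comm]
  have hup (r : ℂ) : F * b * (r • b) = (q ^ 2)⁻¹ • (r • b * (F * b)) := by
    rw [mul_smul_comm, smul_mul_assoc, ← mul_assoc b, hbF, smul_mul_assoc, smul_comm r,
      smul_smul, hq2, one_smul]
  -- the telescoping relations for `E k` and `F b`, transported by conjugation with `X`
  have hφ1 {w v y G : A} (e : y * G * (1 - v) = G * y * (1 - w)) : conjHom X y * conjHom X G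
      * (1 - conjHom X v) = conjHom X G * conjHom X y * (1 - conjHom X w) := by
    simpa only [map_mul, map_sub, map_one] using congrArg (conjHom X) e
  have hφ2 {w v f G : A} (e : (1 - w) * (f * G) = (1 - v) * G * f) : (1 - conjHom X w)
      * (conjHom X f * conjHom X G) = (1 - conjHom X v) * conjHom X G * conjHom X f := by
    simpa only [map_mul, map_sub, map_one] using congrArg (conjHom X) e
  have hR1 := hφ1 (ratio_lower hN hD hwv (hlow _) (hlow _))
  have hR2 := hφ2 (ratio_raise hN hD hwv (hup _) (hup _))
  have hVT := congrArg (conjHom X) (hup 1)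
  rw [hφa, ← hΨ, map_smul, map_smul, hφb] at hR1
  rw [one_smul, map_smul, map_mul, map_mul (conjHom X) b, hφf, hφb] at hVT
  rw [hφf, ← hΨ, map_smul, map_smul, hφb] at hR2
  have hR : (εp • (1 : A) + (q * S⁻¹) • T) * (E * k * Ψ)
      = (εp • (1 : A) + (q * S) • T) * (Ψ * (E * k)) := by
    have e1 : E * k * Ψ * T = (q ^ 2) • (T * (E * k * Ψ)) := by
      rw [mul_assoc, ← hTΨ, ← mul_assoc, haT, smul_mul_assoc, mul_assoc]
    have e2 : Ψ * (E * k) * T = (q ^ 2) • (T * (Ψ * (E * k))) := by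
      rw [mul_assoc, haT, mul_smul_comm, ← mul_assoc, ← hTΨ, mul_assoc]
    simp only [mul_sub, mul_one, mul_smul_comm, e1, e2] at hR1
    simp only [add_mul, smul_mul_assoc, one_mul]
    linear_combination (norm := skip) εp • hR1
    match_scalars <;> field_simp <;> ring
  set V := F * b + γ • b - (γ * εm) • t with hV
  have hRV : V * Ψ * (εp • (1 : A) + (q * S) • T)
      = (εp • (1 : A) + (q⁻¹ * S⁻¹) • T) * Ψ * V := by
    have e1 : V * Ψ * T = (q ^ 2)⁻¹ • (T * (V * Ψ)) := by
      rw [mul_smul_comm, smul_mul_assoc, smul_comm, smul_right_inj (inv_ne_zero hεm)] at hVT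
      rw [mul_assoc, ← hTΨ, ← mul_assoc, hVT, smul_mul_assoc, mul_assoc]
    simp only [sub_mul, one_mul, smul_mul_assoc] at hR2
    simp only [mul_add, add_mul, mul_smul_comm, smul_mul_assoc, one_mul, mul_one, e1]
    linear_combination (norm := skip) εp • hR2
    match_scalars <;> field_simp <;> ring
  have hcart := cartan_relation hTu hTk hTΨ hR
  refine ⟨Ψ, γ, rfl, ?_, ?_, diagonal_relation hTu hTk haT hTΨ hR, hcart,
    opposite_relation hS hkb hbk hkF hTk hkT hTt htT hTΨ hV hRV hcart⟩
  · rw [hγ]; field_simp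
  · simp only [hT, add_mul, mul_add, smul_mul_assoc, mul_smul_comm] at hTΨ
    linear_combination (norm := module) hTΨ

end Dressing

/-! ### The upper triangular operator of the first type -/

theorem qpow_add (h ξ η : ℂ) : qpow h (ξ + η) = qpow h ξ * qpow h η := by
  rw [qpow, add_mul, Complex.exp_add, qpow, qpow]

theorem qpow_neg (h ξ : ℂ) : qpow h (-ξ) = (qpow h ξ)⁻¹ := by
  rw [qpow, neg_mul, Complex.exp_neg, qpow]

theorem qpow_one (h : ℂ) : qpow h 1 = qq h := by rw [qpow, one_mul, qq]

theorem qpow_two (h : ℂ) : qpow h 2 = qq h ^ 2 := by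
  rw [← one_add_one_eq_two, qpow_add, qpow_one, sq]

theorem qpow_mul_int (h u : ℂ) (n : ℤ) : qpow h (u * n) = qpow h u ^ n := by
  rw [qpow, qpow, ← Complex.exp_int_mul]; congr 1; ring

theorem norm_pp_lt_one {h : ℂ} (hq : 1 < ‖qq h‖) : ‖pp h‖ < 1 := by
  rw [pp, norm_inv, norm_pow]
  exact inv_lt_one_of_one_lt₀ (one_lt_pow₀ hq two_ne_zero)

theorem qH_mul_E (h ξ : ℂ) : qH h ξ * E h = qpow h (2 * ξ) • (E h * qH h ξ) := by
  rw [← smul_mul_assoc, ← qH_E, mul_assoc, qH_mul, neg_add_cancel, qH_zero, mul_one]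

theorem qH_mul_F (h ξ : ℂ) : qH h ξ * F h = qpow h (-(2 * ξ)) • (F h * qH h ξ) := by
  rw [← smul_mul_assoc, ← qH_F, mul_assoc, qH_mul, neg_add_cancel, qH_zero, mul_one]

theorem qH_comm (h ξ η : ℂ) : qH h ξ * qH h η = qH h η * qH h ξ := by
  rw [qH_mul, qH_mul, add_comm]

/-- The group-like element `q ^ (ξ H)` as a unit of an algebra over `U_q(sl₂)`. -/
def cartUnit {h : ℂ} {A : Type*} [Ring A] [Algebra ℂ A] (ρ : Uq h →ₐ[ℂ] A) (ξ : ℂ) : Aˣ where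
  val := ρ (qH h ξ)
  inv := ρ (qH h (-ξ))
  val_inv := by rw [← map_mul, qH_mul, add_neg_cancel, qH_zero, map_one]
  inv_val := by rw [← map_mul, qH_mul, neg_add_cancel, qH_zero, map_one]

/-- The image of `L(z)`, with `z ^ s` split into `z ^ s₀ * z ^ s₁`. -/
theorem Lop_map {h : ℂ} (P : Params) {A : Type*} [Ring A] [Algebra ℂ A] (ρ : Uq h →ₐ[ℂ] A)
    {z : ℂ} (hz : z ≠ 0) : (Lop h P z).map ρ =
      !![ρ (qH h (1 / 2)) - ((qq h)⁻¹ * (z ^ P.s₀ * z ^ P.s₁)) • ρ (qH h (-(1 / 2))),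
        (lam h * z ^ P.s₀) • (ρ (F h) * ρ (qH h (-(1 / 2))));
        (lam h * z ^ P.s₁) • (ρ (E h) * ρ (qH h (1 / 2))),
        ρ (qH h (-(1 / 2))) - ((qq h)⁻¹ * (z ^ P.s₀ * z ^ P.s₁)) • ρ (qH h (1 / 2))] := by
  rw [Lop, Params.s, zpow_add₀ hz]
  ext i j
  fin_cases i <;> fin_cases j <;> simp

/-- The image of `L̄(z)`, with `z ^ (-s)` split into inverse powers. -/
theorem LopBar_map {h : ℂ} (P : Params) {A : Type*} [Ring A] [Algebra ℂ A] (ρ : Uq h →ₐ[ℂ] A)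
    {z : ℂ} (hz : z ≠ 0) : (LopBar h P z).map ρ =
      !![ρ (qH h (1 / 2)) - ((qq h)⁻¹ * (z ^ P.s₀ * z ^ P.s₁)⁻¹) • ρ (qH h (-(1 / 2))),
        (lam h * (z ^ P.s₁)⁻¹) • (ρ (F h) * ρ (qH h (-(1 / 2))));
        (lam h * (z ^ P.s₀)⁻¹) • (ρ (E h) * ρ (qH h (1 / 2))),
        ρ (qH h (-(1 / 2))) - ((qq h)⁻¹ * (z ^ P.s₀ * z ^ P.s₁)⁻¹) • ρ (qH h (1 / 2))] := by
  rw [LopBar, Params.s, zpow_neg, zpow_neg, zpow_neg, zpow_add₀ hz]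
  ext i j
  fin_cases i <;> fin_cases j <;> simp

/-- The scalar K-matrix over `A`, for `k₋ = 0`, with `z ^ s` split. -/
theorem Kmat_map {h : ℂ} {P : Params} (hkm : P.km = 0) (A : Type*) [Ring A] [Algebra ℂ A]
    {z : ℂ} (hz : z ≠ 0) : (Kmat h P z).map (algebraMap ℂ A) =
      !![algebraMap ℂ A (z ^ P.s₀ * P.εp + (z ^ P.s₁)⁻¹ * P.εm),
        algebraMap ℂ A (P.kp * (z ^ P.s₀ * z ^ P.s₁ - (z ^ P.s₀ * z ^ P.s₁)⁻¹) / lam h);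
        0, algebraMap ℂ A ((z ^ P.s₀)⁻¹ * P.εp + z ^ P.s₁ * P.εm)] := by
  rw [Kmat, Params.s, zpow_neg, zpow_neg, zpow_neg, zpow_add₀ hz, hkm]
  ext i j
  fin_cases i <;> fin_cases j <;>
    simp only [Matrix.map_apply, Matrix.of_apply, Fin.zero_eta, Fin.mk_one, Matrix.cons_val_zero,
      Matrix.cons_val_one, Matrix.cons_val', Matrix.cons_val_fin_one, Fin.isValue, zero_mul,
      zero_div, map_zero]

section Upper

variable {h : ℂ} {A : Type*} [Ring A] [Algebra ℂ A] [TopologicalSpace A]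
  [IsSemitopologicalRing A] [T2Space A]

/-- The first upper triangular operator solves the reflection equation. -/
theorem IsKUp.reflectionEq (hq : 1 < ‖qq h‖) {u : ℂ} {P : Params} (hεp : P.εp ≠ 0)
    (hεm : P.εm ≠ 0) (hkm : P.km = 0) {ρ : Uq h →ₐ[ℂ] A} {K : A} (hK : IsKUp h P u ρ K)
    {y : ℂ} (hy : y ≠ 0) : ReflectionEq h P ρ K (qpow h u) y := by
  obtain ⟨X, D, N, hX, hN, hD, rfl⟩ := hK
  have hq0 := qq_ne_zero h
  have hl0 := lam_ne_zero h hq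
  have hx : qpow h u ≠ 0 := qpow_ne_zero h u
  have hx0 := zpow_ne_zero P.s₀ hx
  have hx1 := zpow_ne_zero P.s₁ hx
  have hqh : qpow h (2 * (1 / 2)) = qq h := by rw [mul_one_div_cancel two_ne_zero, qpow_one]
  have hZ : qpow h (2 * (u * P.s₀)) = (qpow h u ^ P.s₀) ^ 2 := by
    rw [two_mul, qpow_add, qpow_mul_int, sq]
  have hk : ρ (qH h 1) = ρ (qH h (1 / 2)) * ρ (qH h (1 / 2)) := by
    rw [← map_mul, qH_mul, add_halves]
  have hb : ρ (qH h (-1)) = ρ (qH h (-(1 / 2))) * ρ (qH h (-(1 / 2))) := by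
    rw [← map_mul, qH_mul, ← neg_add, add_halves]
  have hkE : ρ (qH h 1) * ρ (E h) = (qq h ^ 2) • (ρ (E h) * ρ (qH h 1)) := by
    rw [← map_mul, qH_mul_E, map_smul, map_mul, mul_one, qpow_two]
  have hkF : ρ (F h) * ρ (qH h 1) = (qq h ^ 2) • (ρ (qH h 1) * ρ (F h)) := by
    rw [← map_mul, ← map_mul, qH_mul_F, map_smul, smul_smul, mul_one, qpow_neg, qpow_two,
      mul_inv_cancel₀ (pow_ne_zero 2 hq0), one_smul]
  have hEF : ρ (E h) * ρ (F h) - ρ (F h) * ρ (E h)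
      = (lam h)⁻¹ • (ρ (qH h 1) - ρ (qH h (-1))) := by
    rw [← map_mul, ← map_mul, ← map_sub, E_F, map_smul, map_sub]
  have hkb : ρ (qH h 1) * ρ (qH h (-1)) = 1 := (cartUnit ρ 1).mul_inv
  have hbk : ρ (qH h (-1)) * ρ (qH h 1) = 1 := (cartUnit ρ 1).inv_mul
  have hX' : HasQExp (qq h ^ 2)⁻¹ ((-(qq h * (P.kp * qpow h u ^ (-P.s₀))) / (lam h * P.εm))
      • (ρ (E h) * ρ (qH h 1))) (X : A) := by
    rw [map_smul, map_mul] at hX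
    rw [← mul_assoc]; exact hX
  have hS : qpow h u ^ P.s₀ * qpow h u ^ P.s₁ ≠ 0 := mul_ne_zero hx0 hx1
  have hN' : HasQPoch (qq h ^ 2)⁻¹ ((-(P.εm / P.εp) * (qpow h u ^ P.s₀ * qpow h u ^ P.s₁)
      * (qq h)⁻¹) • ρ (qH h (-1))) N := by
    rw [cartLow, map_smul, Params.s, zpow_add₀ hx] at hN
    exact hN
  have hD' : HasQPoch (qq h ^ 2)⁻¹ ((-(P.εm / P.εp) * (qpow h u ^ P.s₀ * qpow h u ^ P.s₁)⁻¹
      * (qq h)⁻¹) • ρ (qH h (-1))) (D : A) := by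
    rw [cartLow, map_smul, Params.s, zpow_neg, zpow_add₀ hx] at hD
    exact hD
  obtain ⟨Ψ, γ, hΨ, hγ, hA, hB, hC, hDD⟩ := dressed_relations (norm_pp_lt_one hq) hq0 rfl hl0 hS
    hεp hεm hkb hbk hkE hkF hEF hX' hN' hD'
  rw [hb] at hA
  rw [hk, hb] at hDD
  rw [hk] at hB hC
  obtain ⟨r1, r2, r3, r4⟩ := relations_of_dressed (Z := ρ (qH h (u * P.s₀))) hq0 hl0 hx0 hx1 hγ
    (cartUnit ρ (1 / 2)).mul_inv (cartUnit ρ (1 / 2)).inv_mul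
    (by change ρ (qH h (1 / 2)) * _ = _ • (_ * ρ (qH h (1 / 2)))
        rw [← map_mul, qH_mul_E, map_smul, map_mul, hqh])
    (by change ρ (qH h (-(1 / 2))) * _ = _ • (_ * ρ (qH h (-(1 / 2))))
        rw [← map_mul, qH_mul_E, map_smul, map_mul, mul_neg, qpow_neg, hqh])
    (by change ρ (qH h (1 / 2)) * _ = _ • (_ * ρ (qH h (1 / 2)))
        rw [← map_mul, qH_mul_F, map_smul, map_mul, qpow_neg, hqh])
    (by change ρ (qH h (-(1 / 2))) * _ = _ • (_ * ρ (qH h (-(1 / 2))))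
        rw [← map_mul, qH_mul_F, map_smul, map_mul, mul_neg, neg_neg, hqh])
    (by change _ * ρ (qH h (1 / 2)) = ρ (qH h (1 / 2)) * _
        rw [← map_mul, qH_comm, map_mul])
    (by change _ * ρ (qH h (-(1 / 2))) = ρ (qH h (-(1 / 2))) * _
        rw [← map_mul, qH_comm, map_mul])
    (by rw [← map_mul, qH_mul_E, map_smul, map_mul, hZ])
    (by rw [← map_mul, qH_mul_F, map_smul, map_mul, qpow_neg, hZ, inv_pow]) hA hB hC hDD
  -- `c = k₊ x ^ (-s₀)`, whence `x ^ s₀ c = k₊`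
  have hc : qpow h u ^ P.s₀ * (P.kp * qpow h u ^ (-P.s₀)) = P.kp := by
    rw [zpow_neg]; field_simp
  rw [hc] at r2 r3 r4
  have hKΨ : ρ (qH h (u * P.s₀)) * ↑X⁻¹ * (N * ↑D⁻¹) * X = ρ (qH h (u * P.s₀)) * Ψ := by
    rw [hΨ]; simp only [mul_assoc]
  rw [hKΨ]
  have := reflection_of_relations _ _ _ _ _ hq0 hl0 hx0 hx1 (zpow_ne_zero P.s₀ hy)
    (zpow_ne_zero P.s₁ hy) r1 r2 r3 r4
  rw [ReflectionEq, Lop_map P ρ (div_ne_zero hy hx), LopBar_map P ρ (mul_ne_zero hx hy),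
    Kmat_map hkm A hy, Lop_map P ρ (one_div_ne_zero (mul_ne_zero hx hy)),
    LopBar_map P ρ (div_ne_zero hx hy)]
  simp only [div_zpow, mul_zpow, one_div, inv_zpow] at this ⊢
  simp only [← mul_inv] at this ⊢
  exact this

/-- Conjugation by the `p`-exponential, carried out inside the infinite products. -/
theorem IsKUp.alt (hq : 1 < ‖qq h‖) {u : ℂ} {P : Params}
    (hεm : P.εm ≠ 0) {ρ : Uq h →ₐ[ℂ] A} {K : A} (hK : IsKUp h P u ρ K) :
    IsKUpAlt h P u ρ K := by
  obtain ⟨X, D, N, hX, hN, hD, rfl⟩ := hK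
  have hq0 := qq_ne_zero h
  have hl0 := lam_ne_zero h hq
  have hX' : HasQExp (qq h ^ 2)⁻¹ ((-(qq h * (P.kp * qpow h u ^ (-P.s₀))) / (lam h * P.εm))
      • (ρ (E h) * ρ (qH h 1))) (X : A) := by
    rw [map_smul, map_mul] at hX
    rw [← mul_assoc]; exact hX
  have hkb : ρ (qH h 1) * ρ (qH h (-1)) = 1 := (cartUnit ρ 1).mul_inv
  have hba : ρ (qH h (-1)) * (ρ (E h) * ρ (qH h 1))
      = (qq h ^ 2)⁻¹ • (ρ (E h) * ρ (qH h 1) * ρ (qH h (-1))) := by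
    rw [← mul_assoc, ← map_mul, qH_mul_E, map_smul, map_mul, smul_mul_assoc, mul_assoc,
      mul_assoc, ← map_mul ρ (qH h (-1)), qH_comm, map_mul, mul_neg, mul_one, qpow_neg, qpow_two]
  have hT := conjHom_cartan (norm_pp_lt_one hq) hq0 rfl hl0 hεm hkb hba hX'
  have hconj (S : ℂ) : ↑X⁻¹ * ρ (cartLow h P S) * X = ρ ((-((qq h)⁻¹ * S) / P.εp) •
      ((P.kp * qpow h u ^ (-P.s₀)) • E h + P.εm • qH h (-1))) := by
    rw [cartLow, map_smul, ← conjHom_apply, map_smul, hT, smul_smul, map_smul, map_add, map_smul,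
      map_smul]
    congr 1
    field_simp
  refine ⟨X⁻¹ * D * X, ↑X⁻¹ * N * X, ?_, ?_, ?_⟩
  · rw [← hconj]; exact hN.conj X
  · rw [← hconj]; exact hD.conj X
  · simp only [mul_inv_rev, inv_inv, Units.val_mul, mul_assoc, Units.mul_inv_cancel_left]

end Upper

/-! ### Transport along the automorphism `σ` -/

theorem liftUq_gen (h : ℂ) {B : Type*} [Ring B] [Algebra ℂ B] (e f : B) (k : ℂ → B)
    (k0 kadd ke kf ef) (g : UqGen) : liftUq h e f k k0 kadd ke kf ef (gen h g) = match g with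
      | UqGen.E => e
      | UqGen.F => f
      | UqGen.cart ξ => k ξ := by
  rw [liftUq, gen, mkUq]
  erw [RingQuot.liftAlgHom_mkAlgHom_apply]
  refine (FreeAlgebra.lift_ι_apply _ _).trans ?_
  cases g <;> rfl

@[simp] theorem sigma_E (h : ℂ) : sigma h (E h) = F h := liftUq_gen h _ _ _ _ _ _ _ _ UqGen.E

@[simp] theorem sigma_F (h : ℂ) : sigma h (F h) = E h := liftUq_gen h _ _ _ _ _ _ _ _ UqGen.F

@[simp] theorem sigma_qH (h ξ : ℂ) : sigma h (qH h ξ) = qH h (-ξ) :=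
  liftUq_gen h _ _ _ _ _ _ _ _ (UqGen.cart ξ)

@[simp] theorem iota_E (h : ℂ) :
    iota h (E h) = MulOpposite.op ((qq h)⁻¹ • (qH h (-1) * F h)) :=
  liftUq_gen h _ _ _ _ _ _ _ _ UqGen.E

@[simp] theorem iota_F (h : ℂ) : iota h (F h) = MulOpposite.op (qq h • (E h * qH h 1)) :=
  liftUq_gen h _ _ _ _ _ _ _ _ UqGen.F

@[simp] theorem iota_qH (h ξ : ℂ) : iota h (qH h ξ) = MulOpposite.op (qH h ξ) :=
  liftUq_gen h _ _ _ _ _ _ _ _ (UqGen.cart ξ)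

theorem sigma_s (P : Params) : P.sigma.s = P.s := add_comm _ _

section Sigma

variable {h : ℂ} {A : Type*} [Ring A] [Algebra ℂ A]

theorem sigma_cartLow (P : Params) (X : ℂ) : sigma h (cartLow h P.sigma X) = cartHigh h P X := by
  simp [cartLow, cartHigh, Params.sigma]

/-- The automorphism `σ` exchanges the two basis vectors of `ℂ²`: both sides of the reflection
equation are permuted simultaneously in rows and columns. -/
theorem ReflectionEq.of_sigma {P : Params} {ρ : Uq h →ₐ[ℂ] A} {K : A} {x y : ℂ}
    (H : ReflectionEq h P.sigma (ρ.comp (sigma h)) K x y) : ReflectionEq h P ρ K x y := by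
  set e := Equiv.swap (0 : Fin 2) 1
  have hL (z : ℂ) : (Lop h P z).map ρ
      = ((Lop h P.sigma z).map (ρ.comp (sigma h))).submatrix e e := by
    rw [Lop, Lop, sigma_s]
    ext i j
    fin_cases i <;> fin_cases j <;> simp [e, Params.sigma]
  have hLB (z : ℂ) : (LopBar h P z).map ρ
      = ((LopBar h P.sigma z).map (ρ.comp (sigma h))).submatrix e e := by
    rw [LopBar, LopBar, sigma_s]
    ext i j
    fin_cases i <;> fin_cases j <;> simp [e, Params.sigma]
  have hKm : (Kmat h P y).map (algebraMap ℂ A)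
      = ((Kmat h P.sigma y).map (algebraMap ℂ A)).submatrix e e := by
    rw [Kmat, Kmat, sigma_s]
    ext i j
    fin_cases i <;> fin_cases j <;> simp [e, Params.sigma, add_comm]
  have hd : Matrix.diagonal (fun _ : Fin 2 => K)
      = (Matrix.diagonal (fun _ : Fin 2 => K)).submatrix e e := by
    rw [Matrix.submatrix_diagonal_equiv]; rfl
  rw [ReflectionEq, hL, hL, hLB, hLB, hKm, hd]
  simp only [Matrix.submatrix_mul_equiv]
  rw [show _ = _ from H]

variable [TopologicalSpace A]

theorem isKLo'_iff_sigma (P : Params) (u : ℂ) (ρ : Uq h →ₐ[ℂ] A) (K : A) :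
    IsKLo' h P u ρ K ↔ IsKUp h P.sigma u (ρ.comp (sigma h)) K := by
  simp only [IsKLo', IsKUp, AlgHom.comp_apply, map_smul, map_mul, sigma_E, sigma_qH,
    sigma_cartLow, sigma_s]
  rfl

theorem isKUp'_iff_sigma (P : Params) (u : ℂ) (ρ : Uq h →ₐ[ℂ] A) (K : A) :
    IsKUp' h P u ρ K ↔ IsKLo h P.sigma u (ρ.comp (sigma h)) K := by
  simp only [IsKUp', IsKLo, AlgHom.comp_apply, map_smul, sigma_F, sigma_qH,
    sigma_cartLow, sigma_s]
  rfl

theorem isKLoAlt'_of_sigma {P : Params} {u : ℂ} {ρ : Uq h →ₐ[ℂ] A} {K : A}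
    (H : IsKUpAlt h P.sigma u (ρ.comp (sigma h)) K) : IsKLoAlt' h P u ρ K := by
  simp only [IsKLoAlt', IsKUpAlt, AlgHom.comp_apply, map_smul, map_add, sigma_E,
    sigma_qH, sigma_s, neg_neg] at H ⊢
  exact H

theorem isKUpAlt'_of_sigma {P : Params} {u : ℂ} {ρ : Uq h →ₐ[ℂ] A} {K : A}
    (H : IsKLoAlt h P.sigma u (ρ.comp (sigma h)) K) : IsKUpAlt' h P u ρ K := by
  simp only [IsKUpAlt', IsKLoAlt, AlgHom.comp_apply, map_smul, map_mul, map_add, sigma_F,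
    sigma_qH, sigma_s, neg_neg] at H ⊢
  exact H

end Sigma

/-! ### Transport along the anti-automorphism `ι` -/

section Iota

open MulOpposite

variable {h : ℂ} {A : Type*} [Ring A] [Algebra ℂ A]

/-- The representation of `U_q(sl₂)` on the opposite algebra obtained from `ρ` through `ι`. -/
noncomputable abbrev opRep (ρ : Uq h →ₐ[ℂ] A) : Uq h →ₐ[ℂ] Aᵐᵒᵖ := (AlgHom.op ρ).comp (iota h)

theorem opRep_E (ρ : Uq h →ₐ[ℂ] A) :
    opRep ρ (E h) = op ((qq h)⁻¹ • (ρ (qH h (-1)) * ρ (F h))) := by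
  simp [opRep]

theorem opRep_F (ρ : Uq h →ₐ[ℂ] A) :
    opRep ρ (F h) = op (qq h • (ρ (E h) * ρ (qH h 1))) := by
  simp [opRep]

theorem opRep_qH (ρ : Uq h →ₐ[ℂ] A) (ξ : ℂ) : opRep ρ (qH h ξ) = op (ρ (qH h ξ)) := by
  simp [opRep]

theorem opRep_cartLow (ρ : Uq h →ₐ[ℂ] A) (P : Params) (X : ℂ) :
    opRep ρ (cartLow h P.iota X) = op (ρ (cartLow h P X)) := by
  rw [cartLow, cartLow, map_smul, map_smul, opRep_qH, op_smul]; rfl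

omit [Algebra ℂ A] in
theorem op_mul_transpose (M N : Matrix (Fin 2) (Fin 2) A) :
    ((M * N).map op).transpose = (N.map op).transpose * (M.map op).transpose := by
  ext i j
  simp [Matrix.mul_apply]

theorem qH_half_F (h : ℂ) : qq h • (F h * qH h (-(1 / 2))) = qH h (-(1 / 2)) * F h := by
  rw [qH_mul_F, mul_neg, neg_neg, mul_one_div_cancel two_ne_zero, qpow_one]

theorem opRep_E_half (ρ : Uq h →ₐ[ℂ] A) :
    opRep ρ (E h * qH h (1 / 2)) = op (ρ (F h * qH h (-(1 / 2)))) := by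
  rw [map_mul, opRep_E, opRep_qH, ← op_mul, mul_smul_comm, ← mul_assoc, ← map_mul, qH_mul,
    show (1 / 2 + -1 : ℂ) = -(1 / 2) by norm_num, ← map_mul, ← qH_half_F, map_smul, smul_smul,
    inv_mul_cancel₀ (qq_ne_zero h), one_smul]

theorem opRep_F_half (ρ : Uq h →ₐ[ℂ] A) :
    opRep ρ (F h * qH h (-(1 / 2))) = op (ρ (E h * qH h (1 / 2))) := by
  rw [map_mul, opRep_F, opRep_qH, ← op_mul, mul_smul_comm, ← mul_assoc, ← map_mul]
  have e : qq h • (qH h (-(1 / 2)) * E h) = E h * qH h (-(1 / 2)) := by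
    rw [qH_mul_E, mul_neg, mul_one_div_cancel two_ne_zero, qpow_neg, qpow_one, smul_smul,
      mul_inv_cancel₀ (qq_ne_zero h), one_smul]
  rw [← smul_mul_assoc, ← map_smul, e, ← map_mul, mul_assoc, qH_mul]
  norm_num

/-- The anti-automorphism `ι` takes `L(z)` to the transpose of `L̄(1/z)`. Transposing the reflection
equation over the opposite algebra reverses all products and exchanges its two sides. -/
theorem ReflectionEq.of_iota {P : Params} {ρ : Uq h →ₐ[ℂ] A} {K : A} {x y : ℂ}
    (H : ReflectionEq h P.iota (opRep ρ) (op K) x y) : ReflectionEq h P ρ K x y := by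
  have hL (z : ℂ) : (Lop h P.iota z).map (opRep ρ)
      = (((LopBar h P z⁻¹).map ρ).map op).transpose := by
    ext i j
    fin_cases i <;> fin_cases j <;>
      simp only [Lop, LopBar, Params.iota, Params.s, inv_zpow', neg_neg, Matrix.map_apply,
        Matrix.transpose_apply, Matrix.of_apply, Fin.zero_eta, Fin.mk_one, Matrix.cons_val_zero,
        Matrix.cons_val_one, Matrix.cons_val', Matrix.cons_val_fin_one, Fin.isValue, map_sub,
        map_smul, opRep_E_half, opRep_F_half, opRep_qH, op_sub, op_smul]
  have hLB (z : ℂ) : (LopBar h P.iota z).map (opRep ρ)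
      = (((Lop h P z⁻¹).map ρ).map op).transpose := by
    ext i j
    fin_cases i <;> fin_cases j <;>
      simp only [Lop, LopBar, Params.iota, Params.s, inv_zpow', Matrix.map_apply,
        Matrix.transpose_apply, Matrix.of_apply, Fin.zero_eta, Fin.mk_one, Matrix.cons_val_zero,
        Matrix.cons_val_one, Matrix.cons_val', Matrix.cons_val_fin_one, Fin.isValue, map_sub,
        map_smul, opRep_E_half, opRep_F_half, opRep_qH, op_sub, op_smul]
  have hKm : (Kmat h P.iota y).map (algebraMap ℂ Aᵐᵒᵖ)
      = (((Kmat h P y).map (algebraMap ℂ A)).map op).transpose := by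
    rw [Kmat, Kmat]
    ext i j
    fin_cases i <;> fin_cases j <;> rfl
  have hd : Matrix.diagonal (fun _ : Fin 2 => op K)
      = ((Matrix.diagonal (fun _ : Fin 2 => K)).map op).transpose := by
    rw [Matrix.diagonal_map op_zero, Matrix.diagonal_transpose]
  rw [ReflectionEq, hL, hL, hLB, hLB, hKm, hd] at H
  simp only [← op_mul_transpose] at H
  have H' := Matrix.map_injective op_injective (Matrix.transpose_injective H)
  simp only [← mul_assoc, inv_div, one_div, inv_inv] at H'
  rw [ReflectionEq, one_div]
  exact H'.symm

end Iota

/-! ### Infinite products and exponentials in the opposite algebra -/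

section IotaLimits

open MulOpposite

section Op

variable {A : Type*} [Ring A] [Algebra ℂ A]

theorem qPoch_op (p : ℂ) (a : A) (n : ℕ) : qPoch p (op a) n = op (qPoch p a n) := by
  induction n with
  | zero => rfl
  | succ n ih =>
    have hc : Commute (1 - p ^ n • a) (qPoch p a n) :=
      commute_qPoch ((Commute.one_left a).sub_left ((Commute.refl a).smul_left _)) n
    rw [qPoch, ih, qPoch, ← hc.eq, op_mul]
    rfl

variable [TopologicalSpace A]

theorem hasQPoch_op_iff {p : ℂ} {a b : A} : HasQPoch p (op a) (op b) ↔ HasQPoch p a b := by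
  rw [HasQPoch, HasQPoch, opHomeomorph.isOpenEmbedding.tendsto_nhds_iff (f := qPoch p a)]
  exact Filter.tendsto_congr (qPoch_op p a)

theorem hasQExp_op_iff {p : ℂ} {a b : A} : HasQExp p (op a) (op b) ↔ HasQExp p a b := by
  rw [HasQExp, HasQExp, opHomeomorph.isOpenEmbedding.tendsto_nhds_iff
    (f := fun n : ℕ => ∑ k ∈ Finset.range n, (qFact p k)⁻¹ • a ^ k)]
  refine Filter.tendsto_congr fun n => ?_
  simp [Function.comp, Finset.op_sum]

end Op

variable {h : ℂ} {A : Type*} [Ring A] [Algebra ℂ A]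

theorem cartUnit_conj_F (ρ : Uq h →ₐ[ℂ] A) (ξ : ℂ) :
    (↑(cartUnit ρ ξ)⁻¹ : A) * ρ (F h) * ↑(cartUnit ρ ξ) = qpow h (2 * ξ) • ρ (F h) := by
  change ρ (qH h (-ξ)) * ρ (F h) * ρ (qH h ξ) = _
  have := qH_F h (-ξ)
  rw [← map_mul, ← map_mul, ← map_smul, ← neg_neg (2 * ξ), ← mul_neg, ← this, neg_neg]

theorem cartUnit_conj_F' (ρ : Uq h →ₐ[ℂ] A) (ξ : ℂ) :
    (↑(cartUnit ρ ξ) : A) * ρ (F h) * ↑(cartUnit ρ ξ)⁻¹ = qpow h (-(2 * ξ)) • ρ (F h) := by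
  change ρ (qH h ξ) * ρ (F h) * ρ (qH h (-ξ)) = _
  rw [← map_mul, ← map_mul, ← map_smul, ← qH_F]

theorem cartUnit_commute (ρ : Uq h →ₐ[ℂ] A) (ξ η : ℂ) :
    Commute (cartUnit ρ ξ : A) (ρ (qH h η)) := by
  change ρ (qH h ξ) * ρ (qH h η) = ρ (qH h η) * ρ (qH h ξ)
  rw [← map_mul, qH_comm, map_mul]

theorem qpow_two_mul_int (h u : ℂ) (n : ℤ) : qpow h (2 * (u * n)) = (qpow h u ^ n) ^ 2 := by
  rw [two_mul, qpow_add, qpow_mul_int, sq]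

theorem opRep_exp_arg (ρ : Uq h →ₐ[ℂ] A) (c : ℂ) :
    opRep ρ (c • (E h * qH h 1)) = op ((c * (qq h)⁻¹) • ρ (F h)) := by
  rw [map_smul, map_mul, opRep_E, opRep_qH, ← op_mul, ← op_smul, mul_smul_comm, ← mul_assoc,
    ← map_mul, qH_mul, add_neg_cancel, qH_zero, map_one, one_mul, smul_smul]

variable [TopologicalSpace A] [IsSemitopologicalRing A] [T2Space A]

theorem HasQPoch.commute_of_commute {p : ℂ} {w v N M : A} (hN : HasQPoch p w N)
    (hM : HasQPoch p v M) (hwv : Commute w v) : Commute N M :=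
  hM.commute (hN.commute hwv.symm).symm

/-- The first lower triangular operator is the image of the upper triangular one under `ι`. Over the
opposite algebra the factor `Z = x ^ (s₀ H)` stands on the right; moving it to the left replaces
`X` by its conjugate under `Z`, which accounts for `x ^ s₀` in place of `x ^ (-s₀)` in the argument
of the exponential. -/
theorem isKLo_iff_iota (P : Params) (u : ℂ) (ρ : Uq h →ₐ[ℂ] A) (K : A) :
    IsKLo h P u ρ K ↔ IsKUp h P.iota u (opRep ρ) (op K) := by
  set Z := cartUnit ρ (u * P.s₀)
  have hx := qpow_ne_zero h u
  have hx0 := zpow_ne_zero P.s₀ hx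
  have hq0 := qq_ne_zero h
  have hZ : (Z : A) = ρ (qH h (u * P.s₀)) := rfl
  have harg : opRep ρ ((-(qq h * P.iota.kp * qpow h u ^ (-P.iota.s₀)) / (lam h * P.iota.εm))
      • (E h * qH h 1)) = op ((-(P.km * (qpow h u ^ P.s₀)⁻¹) / (lam h * P.εm)) • ρ (F h)) := by
    rw [opRep_exp_arg]
    congr 2
    simp only [Params.iota, zpow_neg]
    field_simp
  have hZ1 : (↑Z⁻¹ : A) * ((-(P.km * (qpow h u ^ P.s₀)⁻¹) / (lam h * P.εm)) • ρ (F h)) * Z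
      = (-(P.km * qpow h u ^ P.s₀) / (lam h * P.εm)) • ρ (F h) := by
    rw [mul_smul_comm, smul_mul_assoc, cartUnit_conj_F, qpow_two_mul_int, smul_smul]
    congr 1
    field_simp
  have hZ2 : (Z : A) * ((-(P.km * qpow h u ^ P.s₀) / (lam h * P.εm)) • ρ (F h)) * ↑Z⁻¹
      = (-(P.km * (qpow h u ^ P.s₀)⁻¹) / (lam h * P.εm)) • ρ (F h) := by
    rw [mul_smul_comm, smul_mul_assoc, cartUnit_conj_F', qpow_neg, qpow_two_mul_int, smul_smul]
    congr 1
    field_simp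
  have hcomm {N : A} {D : Aˣ} (hN : HasQPoch (pp h) (ρ (cartLow h P (qpow h u ^ P.s))) N)
      (hD : HasQPoch (pp h) (ρ (cartLow h P (qpow h u ^ (-P.s)))) (D : A)) :
      ↑D⁻¹ * N = N * ↑D⁻¹ ∧ Commute (Z : A) (N * ↑D⁻¹) := by
    rw [cartLow, map_smul] at hN hD
    refine ⟨((hN.commute_of_commute hD
      (((Commute.refl _).smul_left _).smul_right _)).units_inv_right).eq.symm, ?_⟩
    exact (hN.commute ((cartUnit_commute ρ _ _).smul_right _)).mul_right
      (hD.commute ((cartUnit_commute ρ _ _).smul_right _)).units_inv_right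
  constructor
  · rintro ⟨X, D, N, hX, hN, hD, rfl⟩
    obtain ⟨c1, c2⟩ := hcomm hN hD
    refine ⟨Units.opEquiv.symm (op (Z * X * Z⁻¹)), Units.opEquiv.symm (op D), op N, ?_, ?_, ?_, ?_⟩
    · rw [harg, Units.coe_opEquiv_symm, unop_op, hasQExp_op_iff, ← hZ2]
      rw [map_smul] at hX
      exact hX.conj Z⁻¹
    · rw [opRep_cartLow, hasQPoch_op_iff]; exact hN
    · rw [opRep_cartLow, Units.coe_opEquiv_symm, unop_op, hasQPoch_op_iff]; exact hD
    · rw [opRep_qH, ← map_inv, ← map_inv, ← op_inv, ← op_inv, Units.coe_opEquiv_symm,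
        Units.coe_opEquiv_symm, Units.coe_opEquiv_symm, ← op_mul, ← op_mul, ← op_mul, ← op_mul]
      simp only [unop_op]
      rw [c1]
      change _ = op (_ * (_ * (_ * (Z : A))))
      rw [← hZ]
      congr 1
      generalize N * (↑D⁻¹ : A) = G at c2 ⊢
      simp only [Units.val_mul, mul_inv_rev, inv_inv, mul_assoc, Units.inv_mul, mul_one]
      rw [← mul_assoc G, ← c2.eq, mul_assoc, Units.inv_mul_cancel_left]
  · rintro ⟨X', D', N', hX, hN, hD, hK⟩
    obtain ⟨⟨Y⟩, rfl⟩ := Units.opEquiv.symm.surjective X'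
    obtain ⟨⟨D⟩, rfl⟩ := Units.opEquiv.symm.surjective D'
    obtain ⟨N⟩ := N'
    change HasQPoch _ _ (op N) at hN
    change HasQPoch _ _ (op (D : A)) at hD
    change HasQExp _ _ (op (Y : A)) at hX
    rw [opRep_cartLow, hasQPoch_op_iff] at hN hD
    rw [harg, hasQExp_op_iff] at hX
    obtain ⟨c1, c2⟩ := hcomm hN hD
    refine ⟨Z⁻¹ * Y * Z, D, N, ?_, hN, hD, ?_⟩
    · rw [map_smul, ← hZ1]
      exact hX.conj Z
    · rw [opRep_qH] at hK
      change op K = op (ρ (qH h (u * P.s₀))) * op ((↑Y⁻¹ : A)) * (op N * op ((↑D⁻¹ : A)))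
        * op (Y : A) at hK
      rw [← op_mul, ← op_mul, ← op_mul, ← op_mul, c1, ← hZ] at hK
      rw [op_injective hK, ← hZ]
      generalize N * (↑D⁻¹ : A) = G at c2 ⊢
      simp only [Units.val_mul, mul_inv_rev, inv_inv, mul_assoc, Units.mul_inv_cancel_left]
      rw [← mul_assoc (Z : A) G, c2.eq, mul_assoc, Units.mul_inv_cancel_left]

/-- The second expression for the lower triangular operator is obtained from the upper triangular
case in the same way, by conjugating the infinite products with `Z = x ^ (s₀ H)`. -/
theorem isKLoAlt_of_iota {P : Params} {u : ℂ} {ρ : Uq h →ₐ[ℂ] A} {K : A}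
    (H : IsKUpAlt h P.iota u (opRep ρ) (op K)) : IsKLoAlt h P u ρ K := by
  set Z := cartUnit ρ (u * P.s₀)
  have hx := qpow_ne_zero h u
  have hx0 := zpow_ne_zero P.s₀ hx
  have hq0 := qq_ne_zero h
  set T := (P.km * (qpow h u ^ P.s₀)⁻¹ * qq h) • (ρ (F h) * ρ (qH h (-1)))
    + P.εm • ρ (qH h (-1)) with hT
  have harg (c : ℂ) : opRep ρ (c • ((P.iota.kp * qpow h u ^ (-P.iota.s₀)) • E h
      + P.iota.εm • qH h (-1))) = op (c • T) := by
    rw [map_smul, map_add, map_smul, map_smul, opRep_E, opRep_qH, ← op_smul, ← op_smul, ← op_add,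
      ← op_smul, hT, ← map_mul, qH_mul_F, map_smul, mul_neg, neg_neg, mul_one, qpow_two,
      smul_smul, smul_smul, map_mul]
    congr 4
    simp only [Params.iota, zpow_neg]
    field_simp
  have hZT (c : ℂ) : (↑Z⁻¹ : A) * (c • T) * Z = ρ (c • ((P.km * qq h * qpow h u ^ P.s₀)
      • (F h * qH h (-1)) + P.εm • qH h (-1))) := by
    have e1 : (↑Z⁻¹ : A) * ρ (qH h (-1)) * Z = ρ (qH h (-1)) := by
      rw [mul_assoc, ← (cartUnit_commute ρ _ _).eq, Units.inv_mul_cancel_left]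
    rw [← conjHom_apply] at e1 ⊢
    rw [map_smul, hT, map_add, map_smul, map_smul, map_mul, e1, conjHom_apply, cartUnit_conj_F,
      qpow_two_mul_int, map_smul, map_add, map_smul, map_smul, map_mul, smul_mul_assoc, smul_smul]
    congr 3
    field_simp
  obtain ⟨D', N', hN, hD, hK⟩ := H
  obtain ⟨⟨D⟩, rfl⟩ := Units.opEquiv.symm.surjective D'
  obtain ⟨N⟩ := N'
  change HasQPoch _ _ (op N) at hN
  change HasQPoch _ _ (op (D : A)) at hD
  rw [harg, hasQPoch_op_iff] at hN hD
  have c := (hN.commute_of_commute hD (((Commute.refl T).smul_left _).smul_right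
    _)).units_inv_right
  refine ⟨Z⁻¹ * D * Z, ↑Z⁻¹ * N * Z, ?_, ?_, ?_⟩
  · rw [← hZT]; exact hN.conj Z
  · rw [← hZT]; exact hD.conj Z
  · rw [opRep_qH] at hK
    change op K = op (ρ (qH h (u * P.s₀))) * (op N * op ((↑D⁻¹ : A))) at hK
    rw [← op_mul, ← op_mul, ← c.eq] at hK
    rw [op_injective hK]
    change _ = (Z : A) * _
    simp only [Units.val_mul, mul_inv_rev, inv_inv, mul_assoc, Units.mul_inv_cancel_left]
    rfl

end IotaLimits

/-! ### Existence in finite-dimensional representations -/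

section Existence

/-- A multiplicative form of the comparison test: increments dominated by a summable fraction of
the current norm force convergence. -/
theorem exists_tendsto_of_norm_sub_le {R : Type*} [NormedAddCommGroup R] [CompleteSpace R]
    {P : ℕ → R} {e : ℕ → ℝ} (he : Summable e) (he0 : ∀ n, 0 ≤ e n)
    (hP : ∀ n, ‖P (n + 1) - P n‖ ≤ ‖P n‖ * e n) : ∃ L, Tendsto P atTop (𝓝 L) := by
  have hb (n : ℕ) : ‖P n‖ ≤ ‖P 0‖ * Real.exp (∑ i ∈ Finset.range n, e i) := by
    induction n with
    | zero => simp
    | succ n ih =>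
      have h1 : ‖P (n + 1)‖ ≤ ‖P n‖ * (e n + 1) := by
        have := norm_le_norm_add_norm_sub' (P (n + 1)) (P n)
        linarith [hP n]
      rw [Finset.sum_range_succ, Real.exp_add, ← mul_assoc]
      exact h1.trans (mul_le_mul ih (Real.add_one_le_exp _) (by linarith [he0 n]) (by positivity))
  refine cauchySeq_tendsto_of_complete (cauchySeq_of_dist_le_of_summable
    (fun n => ‖P 0‖ * Real.exp (∑' i, e i) * e n) (fun n => ?_) (he.mul_left _))
  rw [dist_comm, dist_eq_norm]
  refine (hP n).trans (mul_le_mul_of_nonneg_right ((hb n).trans ?_) (he0 n))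
  gcongr
  exact he.sum_le_tsum _ fun i _ => he0 i

variable {R : Type*} [NormedRing R] [NormedAlgebra ℂ R]

/-- In a Banach algebra the infinite product `(a; p)_∞` converges for `|p| < 1`. -/
theorem exists_hasQPoch [CompleteSpace R] {p : ℂ} (hp : ‖p‖ < 1) (a : R) :
    ∃ N, HasQPoch p a N := by
  refine exists_tendsto_of_norm_sub_le (e := fun n => ‖p‖ ^ n * ‖a‖)
    ((summable_geometric_of_lt_one (norm_nonneg p) hp).mul_right _) (fun n => by positivity)
    fun n => ?_
  rw [qPoch, mul_sub, mul_one, sub_sub_cancel_left, norm_neg]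
  refine (norm_mul_le _ _).trans (mul_le_mul_of_nonneg_left ?_ (norm_nonneg _))
  rw [← norm_pow]
  exact norm_smul_le _ _

/-- In a Banach algebra `(a; p)_∞` is invertible as soon as all its factors are. -/
theorem exists_unit_hasQPoch [CompleteSpace R] {p : ℂ} (hp : ‖p‖ < 1) (a : R)
    (hu : ∀ j : ℕ, IsUnit (1 - p ^ j • a)) : ∃ D : Rˣ, HasQPoch p a (D : R) := by
  obtain ⟨D, hD⟩ := exists_hasQPoch hp a
  choose v hv using hu
  -- the partial products of the inverses converge as well
  let Q : ℕ → R := fun n => Nat.rec 1 (fun n Q => ↑(v n)⁻¹ * Q) n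
  have hQs (n : ℕ) : Q (n + 1) = ↑(v n)⁻¹ * Q n := rfl
  have hPQ (n : ℕ) : qPoch p a n * Q n = 1 := by
    induction n with
    | zero => exact mul_one 1
    | succ n ih =>
      rw [hQs, qPoch, ← hv, mul_assoc, Units.mul_inv_cancel_left, ih]
  have hQP (n : ℕ) : Q n * qPoch p a n = 1 := by
    induction n with
    | zero => exact mul_one 1
    | succ n ih =>
      rw [hQs, qPoch, ← hv, mul_assoc, ← mul_assoc (Q n), ih, one_mul, Units.inv_mul]
  -- the inverse factors tend to `1`, hence are bounded
  have hlim : Tendsto (fun n => (↑(v n)⁻¹ : R)) atTop (𝓝 1) := by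
    have h1 : Tendsto (fun n => (v n : R)) atTop (𝓝 ((1 : Rˣ) : R)) := by
      have h2 : Tendsto (fun n : ℕ => 1 - p ^ n • a) atTop (𝓝 (1 - (0 : ℂ) • a)) :=
        tendsto_const_nhds.sub ((tendsto_pow_atTop_nhds_zero_of_norm_lt_one hp).smul_const a)
      simpa [hv] using h2
    have h3 := (NormedRing.inverse_continuousAt (1 : Rˣ)).tendsto.comp h1
    simpa [Function.comp_def] using h3
  obtain ⟨C, hC⟩ := hlim.norm.bddAbove_range
  have hC' (n : ℕ) : ‖(↑(v n)⁻¹ : R)‖ ≤ C := hC ⟨n, rfl⟩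
  have hC0 : 0 ≤ C := (norm_nonneg _).trans (hC' 0)
  obtain ⟨D', hD'⟩ : ∃ D', Tendsto Q atTop (𝓝 D') := by
    refine exists_tendsto_of_norm_sub_le (e := fun n => C * (‖p‖ ^ n * ‖a‖))
      (((summable_geometric_of_lt_one (norm_nonneg p) hp).mul_right _).mul_left _)
      (fun n => by positivity) fun n => ?_
    have e1 : Q (n + 1) - Q n = ↑(v n)⁻¹ * (p ^ n • a) * Q n := by
      have : p ^ n • a = 1 - (v n : R) := by rw [hv]; abel
      rw [hQs, this, mul_sub, Units.inv_mul, mul_one, sub_mul, one_mul]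
    rw [e1, mul_comm ‖Q n‖]
    refine (norm_mul_le _ _).trans (mul_le_mul_of_nonneg_right ?_ (norm_nonneg _))
    refine (norm_mul_le _ _).trans (mul_le_mul (hC' n) ?_ (norm_nonneg _) hC0)
    rw [← norm_pow]
    exact norm_smul_le _ _
  refine ⟨⟨D, D', tendsto_nhds_unique (hD.mul hD') ?_, tendsto_nhds_unique (hD'.mul hD) ?_⟩, hD⟩
  · simp only [hPQ]; exact tendsto_const_nhds
  · simp only [hQP]; exact tendsto_const_nhds

/-- An element of a normed algebra that is rescaled by a factor of modulus greater than one under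
conjugation is nilpotent: its powers are rescaled by unboundedly large factors, whereas
conjugation is a bounded operation. -/
theorem isNilpotent_of_conj {a : R} {W : Rˣ} {r : ℂ} (hr : 1 < ‖r‖)
    (h : ↑W * a * ↑W⁻¹ = r • a) : IsNilpotent a := by
  have hpow (n : ℕ) : ↑W * a ^ n * ↑W⁻¹ = r ^ n • a ^ n := by
    rw [← Units.conj_pow, h, smul_pow]
  obtain ⟨n, hn⟩ := pow_unbounded_of_one_lt (‖(W : R)‖ * ‖(↑W⁻¹ : R)‖) hr
  refine ⟨n, norm_le_zero_iff.mp (not_lt.mp fun hpos => ?_)⟩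
  have h1 : ‖r‖ ^ n * ‖a ^ n‖ ≤ ‖(W : R)‖ * ‖(↑W⁻¹ : R)‖ * ‖a ^ n‖ := by
    rw [← norm_pow, ← norm_smul, ← hpow]
    calc _ ≤ ‖(W : R)‖ * ‖a ^ n‖ * ‖(↑W⁻¹ : R)‖ :=
          (norm_mul_le _ _).trans (mul_le_mul_of_nonneg_right (norm_mul_le _ _) (norm_nonneg _))
      _ = _ := by ring
  exact absurd (le_of_mul_le_mul_right h1 hpos) (not_le.mpr hn)

end Existence

/-- The `p`-exponential of a nilpotent element is a finite sum of the form `1 + nilpotent`. No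
condition on `p` is needed. -/
theorem exists_unit_hasQExp {A : Type*} [Ring A] [Algebra ℂ A] [TopologicalSpace A] (p : ℂ)
    {a : A} (ha : IsNilpotent a) : ∃ X : Aˣ, HasQExp p a (X : A) := by
  obtain ⟨m, hm⟩ := ha
  have hS : qExpSum p a (m + 1)
      = 1 + a * ∑ k ∈ Finset.range m, (qFact p (k + 1))⁻¹ • a ^ k := by
    rw [qExpSum, Finset.sum_range_succ', add_comm, Finset.mul_sum]
    congr 1
    · simp [qFact]
    · exact Finset.sum_congr rfl fun k _ => by rw [mul_smul_comm, pow_succ']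
  have hc : Commute a (∑ k ∈ Finset.range m, (qFact p (k + 1))⁻¹ • a ^ k) :=
    Commute.sum_right _ _ _ fun k _ => ((Commute.refl a).pow_right k).smul_right _
  have hu : IsUnit (qExpSum p a (m + 1)) := by
    rw [hS]
    exact (hc.isNilpotent_mul_right ⟨m, hm⟩).isUnit_one_add
  obtain ⟨X, hX⟩ := hu
  refine ⟨X, Tendsto.congr' ?_ tendsto_const_nhds⟩
  filter_upwards [eventually_ge_atTop (m + 1)] with n hn
  rw [hX, qExpSum]
  refine Finset.sum_subset (Finset.range_subset_range.mpr hn) fun k _ hk => ?_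
  have : m ≤ k := by
    have := Finset.mem_range.not.mp hk
    omega
  rw [pow_eq_zero_of_le this hm, smul_zero]

/-! ### Operators on finite-dimensional representations -/

section Matrices

variable {n : ℕ}

-- the topology of the operator norm is the entrywise one, in which convergence is meant
open scoped Matrix.Norms.Operator in
theorem exists_hasQPoch_matrix {p : ℂ} (hp : ‖p‖ < 1) (a : Matrix (Fin n) (Fin n) ℂ) :
    ∃ N, HasQPoch p a N := exists_hasQPoch hp a

open scoped Matrix.Norms.Operator in
theorem exists_unit_hasQPoch_matrix {p : ℂ} (hp : ‖p‖ < 1) (a : Matrix (Fin n) (Fin n) ℂ)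
    (hu : ∀ j : ℕ, IsUnit (1 - p ^ j • a)) :
    ∃ D : (Matrix (Fin n) (Fin n) ℂ)ˣ, HasQPoch p a (D : Matrix (Fin n) (Fin n) ℂ) :=
  exists_unit_hasQPoch hp a hu

open scoped Matrix.Norms.Operator in
theorem isNilpotent_of_conj_matrix {a : Matrix (Fin n) (Fin n) ℂ}
    {W : (Matrix (Fin n) (Fin n) ℂ)ˣ} {r : ℂ} (hr : 1 < ‖r‖)
    (h : (W : Matrix (Fin n) (Fin n) ℂ) * a * (↑W⁻¹ : Matrix (Fin n) (Fin n) ℂ) = r • a) :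
    IsNilpotent a := isNilpotent_of_conj hr h

/-- An element of weight `q²` with respect to some group-like element is nilpotent in every
finite-dimensional representation, so that its `p`-exponential exists and is invertible. -/
theorem exists_exp_of_weight {h : ℂ} (hq : 1 < ‖qq h‖) (ρ : Uq h →ₐ[ℂ] Matrix (Fin n) (Fin n) ℂ)
    (ξ : ℂ) {a : Uq h} (ha : qH h ξ * a = (qq h ^ 2) • (a * qH h ξ)) (c : ℂ) :
    ∃ X : (Matrix (Fin n) (Fin n) ℂ)ˣ, HasQExp (pp h) (ρ (c • a)) (X : Matrix _ _ ℂ) := by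
  refine exists_unit_hasQExp _ (isNilpotent_of_conj_matrix (W := cartUnit ρ ξ)
    (r := qq h ^ 2) ?_ ?_)
  · rw [norm_pow]; exact one_lt_pow₀ hq two_ne_zero
  · change ρ (qH h ξ) * ρ (c • a) * ρ (qH h (-ξ)) = _
    rw [← map_mul, ← map_mul, mul_smul_comm, ha, smul_comm, smul_mul_assoc, smul_mul_assoc,
      mul_assoc, qH_mul, add_neg_cancel, qH_zero, mul_one, map_smul]

theorem weight_E (h : ℂ) : qH h 1 * E h = (qq h ^ 2) • (E h * qH h 1) := by
  rw [qH_mul_E, mul_one, qpow_two]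

theorem weight_F (h : ℂ) : qH h (-1) * F h = (qq h ^ 2) • (F h * qH h (-1)) := by
  rw [qH_mul_F, mul_neg, mul_one, neg_neg, qpow_two]

variable {h : ℂ} (hq : 1 < ‖qq h‖) (u : ℂ) (P : Params)
  (ρ : Uq h →ₐ[ℂ] Matrix (Fin n) (Fin n) ℂ)

include hq

theorem exists_isKUp (hu : ∀ j : ℕ, IsUnit (1 - pp h ^ j • ρ (cartLow h P (qpow h u ^ (-P.s))))) :
    ∃ K, IsKUp h P u ρ K := by
  obtain ⟨N, hN⟩ := exists_hasQPoch_matrix (norm_pp_lt_one hq) (ρ (cartLow h P (qpow h u ^ P.s)))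
  obtain ⟨D, hD⟩ := exists_unit_hasQPoch_matrix (norm_pp_lt_one hq) _ hu
  obtain ⟨X, hX⟩ := exists_exp_of_weight hq ρ 1 (a := E h * qH h 1)
    (by rw [← mul_assoc, weight_E, smul_mul_assoc])
    (-(qq h * P.kp * qpow h u ^ (-P.s₀)) / (lam h * P.εm))
  exact ⟨_, X, D, N, hX, hN, hD, rfl⟩

theorem exists_isKLo (hu : ∀ j : ℕ, IsUnit (1 - pp h ^ j • ρ (cartLow h P (qpow h u ^ (-P.s))))) :
    ∃ K, IsKLo h P u ρ K := by
  obtain ⟨N, hN⟩ := exists_hasQPoch_matrix (norm_pp_lt_one hq) (ρ (cartLow h P (qpow h u ^ P.s)))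
  obtain ⟨D, hD⟩ := exists_unit_hasQPoch_matrix (norm_pp_lt_one hq) _ hu
  obtain ⟨X, hX⟩ := exists_exp_of_weight hq ρ (-1) (weight_F h)
    (-(P.km * qpow h u ^ P.s₀) / (lam h * P.εm))
  exact ⟨_, X, D, N, hX, hN, hD, rfl⟩

end Matrices

/-! ### The fundamental representation -/

section Fundamental

theorem fund_E (h : ℂ) (hq : 1 < ‖qq h‖) : fund h hq (E h) = !![0, 1; 0, 0] :=
  liftUq_gen h _ _ _ _ _ _ _ _ UqGen.E

theorem fund_F (h : ℂ) (hq : 1 < ‖qq h‖) : fund h hq (F h) = !![0, 0; 1, 0] :=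
  liftUq_gen h _ _ _ _ _ _ _ _ UqGen.F

theorem fund_qH (h : ℂ) (hq : 1 < ‖qq h‖) (ξ : ℂ) :
    fund h hq (qH h ξ) = !![qpow h ξ, 0; 0, (qpow h ξ)⁻¹] := by
  rw [← qpow_neg]
  exact liftUq_gen h _ _ _ _ _ _ _ _ (UqGen.cart ξ)

/-- An invertible diagonal matrix. -/
noncomputable def diagUnit {a b : ℂ} (ha : a ≠ 0) (hb : b ≠ 0) : (Matrix (Fin 2) (Fin 2) ℂ)ˣ where
  val := !![a, 0; 0, b]
  inv := !![a⁻¹, 0; 0, b⁻¹]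
  val_inv := by simp [ha, hb, Matrix.one_fin_two]
  inv_val := by simp [ha, hb, Matrix.one_fin_two]

/-- An upper unitriangular matrix. -/
def upUnit (t : ℂ) : (Matrix (Fin 2) (Fin 2) ℂ)ˣ where
  val := !![1, t; 0, 1]
  inv := !![1, -t; 0, 1]
  val_inv := by simp [Matrix.one_fin_two]
  inv_val := by simp [Matrix.one_fin_two]

/-- A lower unitriangular matrix. -/
def loUnit (t : ℂ) : (Matrix (Fin 2) (Fin 2) ℂ)ˣ where
  val := !![1, 0; t, 1]
  inv := !![1, 0; -t, 1]
  val_inv := by simp [Matrix.one_fin_two]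
  inv_val := by simp [Matrix.one_fin_two]

theorem inv_diagUnit {a b : ℂ} (ha : a ≠ 0) (hb : b ≠ 0) :
    (↑(diagUnit ha hb)⁻¹ : Matrix (Fin 2) (Fin 2) ℂ) = !![a⁻¹, 0; 0, b⁻¹] := rfl

theorem val_upUnit (t : ℂ) : (upUnit t : Matrix (Fin 2) (Fin 2) ℂ) = !![1, t; 0, 1] := rfl

theorem inv_upUnit (t : ℂ) : (↑(upUnit t)⁻¹ : Matrix (Fin 2) (Fin 2) ℂ) = !![1, -t; 0, 1] := rfl

theorem val_loUnit (t : ℂ) : (loUnit t : Matrix (Fin 2) (Fin 2) ℂ) = !![1, 0; t, 1] := rfl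

theorem inv_loUnit (t : ℂ) : (↑(loUnit t)⁻¹ : Matrix (Fin 2) (Fin 2) ℂ) = !![1, 0; -t, 1] := rfl

theorem hasQExp_of_sq_eq_zero {A : Type*} [Ring A] [Algebra ℂ A] [TopologicalSpace A] {p : ℂ}
    (hp : ‖p‖ < 1) {a : A} (ha : a ^ 2 = 0) : HasQExp p a (1 + a) := by
  refine Tendsto.congr' ?_ tendsto_const_nhds
  filter_upwards [eventually_ge_atTop 2] with n hn
  have h1 : qExpSum p a 2 = 1 + a := by
    simp [qExpSum, Finset.sum_range_succ, qFact, one_sub_ne_zero_of_norm hp]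
  rw [← h1, qExpSum]
  refine Finset.sum_subset (Finset.range_subset_range.mpr hn) fun k _ hk => ?_
  have : 2 ≤ k := by
    have := Finset.mem_range.not.mp hk
    omega
  rw [pow_eq_zero_of_le this ha, smul_zero]

theorem hasQExp_upUnit {p : ℂ} (hp : ‖p‖ < 1) (t : ℂ) :
    HasQExp p !![0, t; 0, 0] (upUnit t : Matrix (Fin 2) (Fin 2) ℂ) := by
  have e : (upUnit t : Matrix (Fin 2) (Fin 2) ℂ) = 1 + !![0, t; 0, 0] := by
    simp [upUnit, Matrix.one_fin_two]
  rw [e]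
  exact hasQExp_of_sq_eq_zero hp (by rw [sq]; ext i j; fin_cases i <;> fin_cases j <;> simp)

theorem hasQExp_loUnit {p : ℂ} (hp : ‖p‖ < 1) (t : ℂ) :
    HasQExp p !![0, 0; t, 0] (loUnit t : Matrix (Fin 2) (Fin 2) ℂ) := by
  have e : (loUnit t : Matrix (Fin 2) (Fin 2) ℂ) = 1 + !![0, 0; t, 0] := by
    simp [loUnit, Matrix.one_fin_two]
  rw [e]
  exact hasQExp_of_sq_eq_zero hp (by rw [sq]; ext i j; fin_cases i <;> fin_cases j <;> simp)

theorem hasQPoch_diag {p x y a b : ℂ} (ha : HasQPoch p x a) (hb : HasQPoch p y b) :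
    HasQPoch p !![x, 0; 0, y] !![a, 0; 0, b] := by
  have e (n : ℕ) : qPoch p !![x, 0; 0, y] n = !![qPoch p x n, 0; 0, qPoch p y n] := by
    induction n with
    | zero => simp [qPoch, Matrix.one_fin_two]
    | succ n ih =>
      rw [qPoch, ih]
      ext i j
      fin_cases i <;> fin_cases j <;> simp [qPoch, Matrix.mul_apply, Matrix.one_fin_two]
  refine tendsto_pi_nhds.mpr fun i => tendsto_pi_nhds.mpr fun j => ?_
  simp only [e]
  fin_cases i <;> fin_cases j
  · exact ha
  · exact tendsto_const_nhds
  · exact tendsto_const_nhds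
  · exact hb

/-- `(z; p)_∞ = (1 - z) (z p; p)_∞`. -/
theorem HasQPoch.succ {p z a : ℂ} (ha : HasQPoch p (z * p) a) : HasQPoch p z ((1 - z) * a) := by
  refine (tendsto_add_atTop_iff_nat 1).mp ((ha.const_mul (1 - z)).congr fun n => ?_)
  rw [qPoch_succ', smul_eq_mul, mul_comm p]

/-! The next four identities evaluate the operators in the fundamental representation. In them `a`
and `b` stand for the shifted factorials that start at the factor with `j = 1`, `d` for the factor
of the denominator with `j = 0`, and `z`, `w` for `x ^ s₀`, `x ^ s₁`. -/

theorem conj_up_low {a b d εp εm z w l k : ℂ} (hb : b ≠ 0) (hd : d ≠ 0) (hεp : εp ≠ 0)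
    (hεm : εm ≠ 0) (hz : z ≠ 0) (hw : w ≠ 0) (hl : l ≠ 0)
    (hdef : 1 + εm / εp * (z * w)⁻¹ = d) :
    (a / (εp * (d * b))) • !![z * εp + w⁻¹ * εm, k * (z * w - (z * w)⁻¹) / l;
        0, z⁻¹ * εp + w * εm]
      = !![z, 0; 0, z⁻¹] * !![1, -(-(k * z⁻¹) / (l * εm)); 0, 1]
        * (!![a, 0; 0, (1 + εm / εp * (z * w)) * a] * !![b⁻¹, 0; 0, (d * b)⁻¹])
        * !![1, -(k * z⁻¹) / (l * εm); 0, 1] := by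
  field_simp at hdef
  ext i j
  fin_cases i <;> fin_cases j <;> simp
  · field_simp
    linear_combination a * hdef
  · field_simp
    linear_combination -(a * k) * hdef
  · field_simp

theorem conj_lo_low {a b d εp εm z w l k : ℂ} (hb : b ≠ 0) (hd : d ≠ 0) (hεp : εp ≠ 0)
    (hεm : εm ≠ 0) (hz : z ≠ 0) (hw : w ≠ 0) (hl : l ≠ 0)
    (hdef : 1 + εm / εp * (z * w)⁻¹ = d) :
    (a / (εp * (d * b))) • !![z * εp + w⁻¹ * εm, 0;
        k * (z * w - (z * w)⁻¹) / l, z⁻¹ * εp + w * εm]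
      = !![z, 0; 0, z⁻¹] * !![1, 0; -(k * z) / (l * εm), 1]
        * (!![a, 0; 0, (1 + εm / εp * (z * w)) * a] * !![b⁻¹, 0; 0, (d * b)⁻¹])
        * !![1, 0; -(-(k * z) / (l * εm)), 1] := by
  field_simp at hdef
  ext i j
  fin_cases i <;> fin_cases j <;> simp
  · field_simp
    linear_combination a * hdef
  · field_simp
    linear_combination -(a * k) * hdef
  · field_simp

theorem conj_lo_high {a b d εp εm z w l k : ℂ} (hb : b ≠ 0) (hd : d ≠ 0) (hεp : εp ≠ 0)
    (hεm : εm ≠ 0) (hz : z ≠ 0) (hw : w ≠ 0) (hl : l ≠ 0)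
    (hdef : 1 + εp / εm * (z * w)⁻¹ = d) :
    (a / (εm * (d * b))) • !![z * εp + w⁻¹ * εm, 0;
        k * (z * w - (z * w)⁻¹) / l, z⁻¹ * εp + w * εm]
      = !![w⁻¹, 0; 0, w] * !![1, 0; -(-(k * w⁻¹) / (l * εp)), 1]
        * (!![(1 + εp / εm * (z * w)) * a, 0; 0, a] * !![(d * b)⁻¹, 0; 0, b⁻¹])
        * !![1, 0; -(k * w⁻¹) / (l * εp), 1] := by
  field_simp at hdef
  ext i j
  fin_cases i <;> fin_cases j <;> simp
  · field_simp
    ring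
  · field_simp
    linear_combination -(a * k) * hdef
  · field_simp
    linear_combination a * hdef

theorem conj_up_high {a b d εp εm z w l k : ℂ} (hb : b ≠ 0) (hd : d ≠ 0) (hεp : εp ≠ 0)
    (hεm : εm ≠ 0) (hz : z ≠ 0) (hw : w ≠ 0) (hl : l ≠ 0)
    (hdef : 1 + εp / εm * (z * w)⁻¹ = d) :
    (a / (εm * (d * b))) • !![z * εp + w⁻¹ * εm, k * (z * w - (z * w)⁻¹) / l;
        0, z⁻¹ * εp + w * εm]
      = !![w⁻¹, 0; 0, w] * !![1, -(k * w) / (l * εp); 0, 1]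
        * (!![(1 + εp / εm * (z * w)) * a, 0; 0, a] * !![(d * b)⁻¹, 0; 0, b⁻¹])
        * !![1, -(-(k * w) / (l * εp)); 0, 1] := by
  field_simp at hdef
  ext i j
  fin_cases i <;> fin_cases j <;> simp
  · field_simp
    ring
  · field_simp
    linear_combination -(a * k) * hdef
  · field_simp
    linear_combination a * hdef

variable {h : ℂ} (hq : 1 < ‖qq h‖) (u : ℂ) (P : Params)

/-- The scalar products that occur in the fundamental representation, with `S = x ^ s`. The products
at `-r S` and `-r S⁻¹` are written as their first factor times the remaining product. -/
theorem exists_scalar_poch (hq : 1 < ‖qq h‖) {r S : ℂ}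
    (hr : ∀ j : ℕ, 1 + r * S⁻¹ * pp h ^ j ≠ 0) :
    ∃ a b : ℂ, b ≠ 0 ∧ 1 + r * S⁻¹ ≠ 0 ∧ HasQPoch (pp h) (-r * S * pp h) a ∧
      HasQPoch (pp h) (-r * S) ((1 + r * S) * a) ∧ HasQPoch (pp h) (-r * S⁻¹ * pp h) b ∧
      HasQPoch (pp h) (-r * S⁻¹) ((1 + r * S⁻¹) * b) := by
  have hp := norm_pp_lt_one hq
  obtain ⟨a, ha⟩ := exists_hasQPoch hp (-r * S * pp h)
  obtain ⟨b, hb⟩ := exists_unit_hasQPoch hp (-r * S⁻¹ * pp h) (fun j => by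
    rw [isUnit_iff_ne_zero, smul_eq_mul]
    convert hr (j + 1) using 1
    ring)
  refine ⟨a, b, b.ne_zero, by simpa using hr 0, ha, ?_, hb, ?_⟩
  · simpa using ha.succ
  · simpa using hb.succ

theorem fund_cartLow (X : ℂ) : fund h hq (cartLow h P X) =
    !![-(P.εm / P.εp) * X * pp h, 0; 0, -(P.εm / P.εp) * X] := by
  have := qq_ne_zero h
  rw [cartLow, map_smul, fund_qH, qpow_neg, qpow_one, pp]
  ext i j
  fin_cases i <;> fin_cases j <;> simp <;> field_simp

theorem fund_cartHigh (X : ℂ) : fund h hq (cartHigh h P X) =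
    !![-(P.εp / P.εm) * X, 0; 0, -(P.εp / P.εm) * X * pp h] := by
  have := qq_ne_zero h
  rw [cartHigh, map_smul, fund_qH, qpow_one, pp]
  ext i j
  fin_cases i <;> fin_cases j <;> simp <;> field_simp

theorem zpow_s {x : ℂ} (hx : x ≠ 0) (P : Params) : x ^ P.s = x ^ P.s₀ * x ^ P.s₁ :=
  zpow_add₀ hx _ _

theorem zpow_neg_s {x : ℂ} (hx : x ≠ 0) (P : Params) : x ^ (-P.s) = (x ^ P.s₀ * x ^ P.s₁)⁻¹ := by
  rw [zpow_neg, zpow_s hx]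

theorem Kmat_eq (h : ℂ) (P : Params) {x : ℂ} (hx : x ≠ 0) : Kmat h P x =
    !![x ^ P.s₀ * P.εp + (x ^ P.s₁)⁻¹ * P.εm,
        P.kp * (x ^ P.s₀ * x ^ P.s₁ - (x ^ P.s₀ * x ^ P.s₁)⁻¹) / lam h;
      P.km * (x ^ P.s₀ * x ^ P.s₁ - (x ^ P.s₀ * x ^ P.s₁)⁻¹) / lam h,
        (x ^ P.s₀)⁻¹ * P.εp + x ^ P.s₁ * P.εm] := by
  rw [Kmat, zpow_neg_s hx, zpow_s hx, zpow_neg, zpow_neg]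

theorem fund_E_qH (c : ℂ) :
    fund h hq ((-(qq h * c) / (lam h * P.εm)) • (E h * qH h 1))
      = !![0, -c / (lam h * P.εm); 0, 0] := by
  have := qq_ne_zero h
  rw [map_smul, map_mul, fund_E, fund_qH, qpow_one]
  ext i j
  fin_cases i <;> fin_cases j <;> simp
  field_simp

theorem fund_F_qH (c : ℂ) :
    fund h hq ((-(qq h * c) / (lam h * P.εp)) • (F h * qH h (-1)))
      = !![0, 0; -c / (lam h * P.εp), 0] := by
  have := qq_ne_zero h
  rw [map_smul, map_mul, fund_F, fund_qH, qpow_neg, qpow_one]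
  ext i j
  fin_cases i <;> fin_cases j <;> simp
  field_simp

theorem fund_smul_E (c : ℂ) : fund h hq (c • E h) = !![0, c; 0, 0] := by
  rw [map_smul, fund_E]
  ext i j
  fin_cases i <;> fin_cases j <;> simp

theorem fund_smul_F (c : ℂ) : fund h hq (c • F h) = !![0, 0; c, 0] := by
  rw [map_smul, fund_F]
  ext i j
  fin_cases i <;> fin_cases j <;> simp

/-- The first upper and the first lower triangular operator in the fundamental representation. -/
theorem fund_low (hεp : P.εp ≠ 0) (hεm : P.εm ≠ 0)
    (hr : ∀ j : ℕ, 1 + P.εm / P.εp * qpow h u ^ (-P.s) * pp h ^ j ≠ 0) :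
    ∃ κ : ℂ, IsKappa h P u P.εp (P.εm / P.εp) κ ∧
      (P.km = 0 → IsKUp h P u (fund h hq) (κ • Kmat h P (qpow h u))) ∧
      (P.kp = 0 → IsKLo h P u (fund h hq) (κ • Kmat h P (qpow h u))) := by
  have hp := norm_pp_lt_one hq
  have hl0 := lam_ne_zero h hq
  have hx := qpow_ne_zero h u
  have hz := zpow_ne_zero P.s₀ hx
  have hw := zpow_ne_zero P.s₁ hx
  have hs := zpow_s hx P
  have hs' := zpow_neg_s hx P
  have hK := Kmat_eq h P hx
  rw [hs'] at hr
  obtain ⟨a, b, hb0, hd0, ha, ha', hb, hb'⟩ := exists_scalar_poch hq hr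
  have hN := hasQPoch_diag ha ha'
  have hD := hasQPoch_diag hb hb'
  rw [← fund_cartLow hq] at hN hD
  refine ⟨a / (P.εp * ((1 + P.εm / P.εp * (qpow h u ^ P.s₀ * qpow h u ^ P.s₁)⁻¹) * b)),
    ⟨a, _, mul_ne_zero hd0 hb0, by rw [hs]; exact ha,
      by rw [hs']; exact hb', rfl⟩, fun hk => ?_, fun hk => ?_⟩
  · refine ⟨upUnit (-(P.kp * (qpow h u ^ P.s₀)⁻¹) / (lam h * P.εm)),
      diagUnit hb0 (mul_ne_zero hd0 hb0), _, ?_,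
      by rw [hs]; exact hN, by rw [hs']; exact hD, ?_⟩
    · rw [mul_assoc (qq h), fund_E_qH, zpow_neg]
      exact hasQExp_upUnit hp _
    · rw [hK, hk, zero_mul, zero_div, fund_qH, qpow_mul_int, inv_diagUnit, val_upUnit, inv_upUnit]
      exact conj_up_low hb0 hd0 hεp hεm hz hw hl0 rfl
  · refine ⟨loUnit (-(P.km * qpow h u ^ P.s₀) / (lam h * P.εm)),
      diagUnit hb0 (mul_ne_zero hd0 hb0), _, ?_,
      by rw [hs]; exact hN, by rw [hs']; exact hD, ?_⟩
    · rw [fund_smul_F]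
      exact hasQExp_loUnit hp _
    · rw [hK, hk, zero_mul, zero_div, fund_qH, qpow_mul_int, inv_diagUnit, val_loUnit, inv_loUnit]
      exact conj_lo_low hb0 hd0 hεp hεm hz hw hl0 rfl

/-- The second lower and the second upper triangular operator in the fundamental representation. -/
theorem fund_high (hεp : P.εp ≠ 0) (hεm : P.εm ≠ 0)
    (hr : ∀ j : ℕ, 1 + P.εp / P.εm * qpow h u ^ (-P.s) * pp h ^ j ≠ 0) :
    ∃ κ : ℂ, IsKappa h P u P.εm (P.εp / P.εm) κ ∧
      (P.kp = 0 → IsKLo' h P u (fund h hq) (κ • Kmat h P (qpow h u))) ∧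
      (P.km = 0 → IsKUp' h P u (fund h hq) (κ • Kmat h P (qpow h u))) := by
  have hp := norm_pp_lt_one hq
  have hl0 := lam_ne_zero h hq
  have hx := qpow_ne_zero h u
  have hz := zpow_ne_zero P.s₀ hx
  have hw := zpow_ne_zero P.s₁ hx
  have hs := zpow_s hx P
  have hs' := zpow_neg_s hx P
  have hK := Kmat_eq h P hx
  rw [hs'] at hr
  obtain ⟨a, b, hb0, hd0, ha, ha', hb, hb'⟩ := exists_scalar_poch hq hr
  have hN := hasQPoch_diag ha' ha
  have hD := hasQPoch_diag hb' hb
  rw [← fund_cartHigh hq] at hN hD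
  refine ⟨a / (P.εm * ((1 + P.εp / P.εm * (qpow h u ^ P.s₀ * qpow h u ^ P.s₁)⁻¹) * b)),
    ⟨a, _, mul_ne_zero hd0 hb0, by rw [hs]; exact ha,
      by rw [hs']; exact hb', rfl⟩, fun hk => ?_, fun hk => ?_⟩
  · refine ⟨loUnit (-(P.km * (qpow h u ^ P.s₁)⁻¹) / (lam h * P.εp)),
      diagUnit (mul_ne_zero hd0 hb0) hb0, _, ?_,
      by rw [hs]; exact hN, by rw [hs']; exact hD, ?_⟩
    · rw [mul_assoc (qq h), fund_F_qH, zpow_neg]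
      exact hasQExp_loUnit hp _
    · rw [hK, hk, zero_mul, zero_div, fund_qH, qpow_neg, qpow_mul_int, inv_inv,
        inv_diagUnit, val_loUnit, inv_loUnit]
      exact conj_lo_high hb0 hd0 hεp hεm hz hw hl0 rfl
  · refine ⟨upUnit (-(P.kp * qpow h u ^ P.s₁) / (lam h * P.εp)),
      diagUnit (mul_ne_zero hd0 hb0) hb0, _, ?_,
      by rw [hs]; exact hN, by rw [hs']; exact hD, ?_⟩
    · rw [fund_smul_E]
      exact hasQExp_upUnit hp _
    · rw [hK, hk, zero_mul, zero_div, fund_qH, qpow_neg, qpow_mul_int, inv_inv,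
        inv_diagUnit, val_upUnit, inv_upUnit]
      exact conj_up_high hb0 hd0 hεp hεm hz hw hl0 rfl

end Fundamental

/-! ### The lower triangular operator of the first type -/

section

variable {h : ℂ} {P : Params} {u : ℂ} {A : Type*} [Ring A] [Algebra ℂ A] [TopologicalSpace A]
  [IsSemitopologicalRing A] [T2Space A] {ρ : Uq h →ₐ[ℂ] A} {K : A}

theorem IsKLo.alt (hq : 1 < ‖qq h‖) (hεm : P.εm ≠ 0) (hK : IsKLo h P u ρ K) :
    IsKLoAlt h P u ρ K :=
  isKLoAlt_of_iota (IsKUp.alt (P := P.iota) hq hεm ((isKLo_iff_iota P u ρ K).mp hK))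

theorem IsKLo.reflectionEq (hq : 1 < ‖qq h‖) (hεp : P.εp ≠ 0) (hεm : P.εm ≠ 0) (hkp : P.kp = 0)
    (hK : IsKLo h P u ρ K) {y : ℂ} (hy : y ≠ 0) : ReflectionEq h P ρ K (qpow h u) y :=
  ReflectionEq.of_iota
    (IsKUp.reflectionEq (P := P.iota) hq hεp hεm hkp ((isKLo_iff_iota P u ρ K).mp hK) hy)

end
end QRefl

open QRefl in
theorem theorem2 (h : ℂ) (hq : 1 < ‖qq h‖) (u : ℂ) (P : Params)
    (hεp : P.εp ≠ 0) (hεm : P.εm ≠ 0) :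
    -- in every algebra in which the formulas make sense
    (∀ (A : Type*) [Ring A] [Algebra ℂ A] [TopologicalSpace A] [IsSemitopologicalRing A]
        [T2Space A] (ρ : Uq h →ₐ[ℂ] A) (K : A),
      -- the operators are well-defined, have two expressions, and solve the reflection equation
      (P.km = 0 → IsKUp h P u ρ K →
        IsKUpAlt h P u ρ K ∧ ∀ y : ℂ, y ≠ 0 → ReflectionEq h P ρ K (qpow h u) y) ∧
      (P.kp = 0 → IsKLo h P u ρ K →
        IsKLoAlt h P u ρ K ∧ ∀ y : ℂ, y ≠ 0 → ReflectionEq h P ρ K (qpow h u) y) ∧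
      (P.kp = 0 → IsKLo' h P u ρ K →
        IsKLoAlt' h P u ρ K ∧ ∀ y : ℂ, y ≠ 0 → ReflectionEq h P ρ K (qpow h u) y) ∧
      (P.km = 0 → IsKUp' h P u ρ K →
        IsKUpAlt' h P u ρ K ∧ ∀ y : ℂ, y ≠ 0 → ReflectionEq h P ρ K (qpow h u) y) ∧
      -- the variants are the images of the first operator under `ι`, `σ` and `σ ∘ ι`
      (IsKLo h P u ρ K ↔
        IsKUp h P.iota u ((AlgHom.op ρ).comp (iota h)) (MulOpposite.op K)) ∧
      (IsKLo' h P u ρ K ↔ IsKUp h P.sigma u (ρ.comp (sigma h)) K) ∧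
      (IsKUp' h P u ρ K ↔ IsKLo h P.sigma u (ρ.comp (sigma h)) K)) ∧
    -- in every finite-dimensional representation without a vanishing denominator they exist
    (∀ (n : ℕ) (ρ : Uq h →ₐ[ℂ] Matrix (Fin n) (Fin n) ℂ),
      ((∀ j : ℕ, IsUnit (1 - pp h ^ j • ρ (cartLow h P (qpow h u ^ (-P.s))))) →
        (∃ K, IsKUp h P u ρ K) ∧ ∃ K, IsKLo h P u ρ K) ∧
      ((∀ j : ℕ, IsUnit (1 - pp h ^ j • ρ (cartHigh h P (qpow h u ^ (-P.s))))) →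
        (∃ K, IsKLo' h P u ρ K) ∧ ∃ K, IsKUp' h P u ρ K)) ∧
    -- in the fundamental representation they are the triangular K-matrices
    ((∀ j : ℕ, 1 + P.εm / P.εp * qpow h u ^ (-P.s) * pp h ^ j ≠ 0) →
      ∃ κ : ℂ, IsKappa h P u P.εp (P.εm / P.εp) κ ∧
        (P.km = 0 → IsKUp h P u (fund h hq) (κ • Kmat h P (qpow h u))) ∧
        (P.kp = 0 → IsKLo h P u (fund h hq) (κ • Kmat h P (qpow h u)))) ∧
    ((∀ j : ℕ, 1 + P.εp / P.εm * qpow h u ^ (-P.s) * pp h ^ j ≠ 0) →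
      ∃ κ : ℂ, IsKappa h P u P.εm (P.εp / P.εm) κ ∧
        (P.kp = 0 → IsKLo' h P u (fund h hq) (κ • Kmat h P (qpow h u))) ∧
        (P.km = 0 → IsKUp' h P u (fund h hq) (κ • Kmat h P (qpow h u)))) := by
  refine ⟨fun A _ _ _ _ _ ρ K =>
      ⟨fun hk hK => ⟨hK.alt hq hεm, fun y hy => hK.reflectionEq hq hεp hεm hk hy⟩,
      fun hk hK => ⟨hK.alt hq hεm, fun y hy => hK.reflectionEq hq hεp hεm hk hy⟩,
      fun hk hK => ?_, fun hk hK => ?_,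
      isKLo_iff_iota P u ρ K, isKLo'_iff_sigma P u ρ K, isKUp'_iff_sigma P u ρ K⟩,
    fun n ρ => ⟨fun hu => ⟨exists_isKUp hq u P ρ hu, exists_isKLo hq u P ρ hu⟩, fun hu => ?_⟩,
    fund_low hq u P hεp hεm, fund_high hq u P hεp hεm⟩
  -- `σ` exchanges `ε₊` with `ε₋` and `k₊` with `k₋`
  · rw [isKLo'_iff_sigma] at hK
    exact ⟨isKLoAlt'_of_sigma (IsKUp.alt (P := P.sigma) hq hεp hK), fun y hy =>
      ReflectionEq.of_sigma (IsKUp.reflectionEq (P := P.sigma) hq hεm hεp hk hK hy)⟩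
  · rw [isKUp'_iff_sigma] at hK
    exact ⟨isKUpAlt'_of_sigma (IsKLo.alt (P := P.sigma) hq hεp hK), fun y hy =>
      ReflectionEq.of_sigma (IsKLo.reflectionEq (P := P.sigma) hq hεm hεp hk hK hy)⟩
  · have hu' : ∀ j : ℕ, IsUnit (1 - pp h ^ j •
        (ρ.comp (sigma h)) (cartLow h P.sigma (qpow h u ^ (-P.sigma.s)))) := by
      simpa only [AlgHom.comp_apply, sigma_cartLow, sigma_s] using hu
    obtain ⟨K, hK⟩ := exists_isKUp hq u P.sigma _ hu'
    obtain ⟨K', hK'⟩ := exists_isKLo hq u P.sigma _ hu'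
    exact ⟨⟨K, (isKLo'_iff_sigma P u ρ K).mpr hK⟩, ⟨K', (isKUp'_iff_sigma P u ρ K').mpr hK'⟩⟩
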